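/- **Conventions.** Let $(\Omega,\mathcal A,\mu)$ be a measure space and $X$ a real Banach space with dual $X'$; $\mathcal S(X)$ is the set of separable subsets of $X$. An *atom* is a set $A\in\mathcal A$ with $\mu(A)>0$ such that $\mu(B)\in\{0,\mu(A)\}$ for all measurable $B\subset A$. Let $\mathcal A_{a\sigma}$ be the system of the sets that are the union of countably many atoms and a measurable $\sigma$-finite set. A measurability property holds *integrally* if it holds on each $A\in\mathcal A_{a\sigma}$; a property holds *i.a.e.* (integrally almost everywhere) if it holds a.e. on each $A\in\mathcal A_{a\sigma}$. (If $\mu$ is $\sigma$-finite, i.a.e. means a.e., and "integrally" may be dropped.) For a family of extended real functions $\alpha_A$, $A\in\mathcal A_{a\sigma}$, each measurable on $A$ with respect to the completion and with $\alpha_A=\alpha_B$ a.e. on $A\cap B$, the *exhausting integral* is $\int\alpha^+-\int\alpha^-$ with $\int\alpha^\pm=\sup_{A\in\mathcal A_{a\sigma}}\int_A\alpha_A^\pm\,d\bar\mu$ and $\infty-\infty:=\infty$; a single function is the family of its restrictions. All integrals below are exhausting integrals; for $\sigma$-finite $\mu$ they are extended Lebesgue integrals. A set $R$ of functions $\Omega\to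 X$ is *almost decomposable* if for all $u_0\in R$, $F\in\mathcal A$ with $\mu(F)<\infty$, $\varepsilon>0$ and bounded strongly measurable $u_1:F\to X$ there is a measurable $F_\varepsilon\subset F$ with $\mu(F\setminus F_\varepsilon)<\varepsilon$ such that the function equal to $u_1$ on $F_\varepsilon$ and to $u_0$ on $\Omega\setminus F_\varepsilon$ belongs to $R$. For $g:X\to[-\infty,\infty]$ and $W\subset X$, $\partial g_W(x)$ is the set of $x'\in X'$ such that $x\in W$, $g(x)\in\mathbb R$ and $g(y)\ge g(x)+\langle x',y-x\rangle$ for all $y\in W$; put $\partial g=\partial g_X$ and $g^*(x')=\sup_{x\in X}\langle x',x\rangle-g(x)$. **Theorem.** Let $R$ be an almost decomposable linear space of integrally strongly measurable functions $\Omega\to X$, and $S$ a linear space of integrally weak* measurable functions $\Omega\to X'$ such that $\langle u,v\rangle=\int\langle v(\omega),u(\omega)\rangle\,d\mu(\omega)$ is finite for all $u\in R$, $v\in S$. Let $f:\Omega\times X\to[-\infty,\infty]$ be integrally separably measurable, i.e. $f|_{A\times W}$ is $\mathcal A(A)\otimes\mathcal B(W)$-measurable for all $A\in\mathcal A_{a\sigma}$,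 $W\in\mathcal S(X)$, where $\mathcal A(A)$ is the trace of $\mathcal A$ on $A$. Let $I_f(u)=\int f(\omega,u(\omega))\,d\mu(\omega)$ and suppose $I_f\not\equiv\infty$ on $R$. Put $$I_f^*(v)=\sup_{u\in R}\langle u,v\rangle-I_f(u),\qquad \partial I_f(u)=\{v\in S: I_f(w)\ge I_f(u)+\langle w-u,v\rangle\ \ \forall w\in R\}\quad\text{for } u\in R,\ I_f(u)\in\mathbb R .$$ Let $v\in S$ be such that for every atom $A$ with $\mu(A)=\infty$ and every $W\in\mathcal S(X)$ one has $\sup_{x\in W}\langle v(\omega),x\rangle-f_\omega(x)\le0$ for a.e. $\omega\in A$. Then: 1. On each $A\in\mathcal A_{a\sigma}$ the essential supremum function of the family $\omega\mapsto\sup_{x\in W}\langle v(\omega),x\rangle-f_\omega(x)$, $W\in\mathcal S(X)$, exists, and $$I_f^*(v)=\int\operatorname*{ess\,sup}_{W\in\mathcal S(X)}\ \sup_{x\in W}\langle v(\omega),x\rangle-f_\omega(x)\,d\bar\mu(\omega).$$ 2. Let $u\in R$ with $I_f(u)\in\mathbb R$. Then $v\in\partial I_f(u)$ if and only if for every $A\in\mathcal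 A_{a\sigma}$ and every $W\in\mathcal S(X)$ with $u(\omega)\in W$ for a.e. $\omega\in A$ one has $v(\omega)\in\partial (f_\omega)_W(u(\omega))$ for a.e. $\omega\in A$. If the set $\mathcal S_u(X)$ of those $W\in\mathcal S(X)$ with $u(\omega)\in W$ i.a.e. is non-empty, this is equivalent to $$v\in\bigcap_{W\in\mathcal S_u(X)}\{v'\in S: v'(\omega)\in\partial (f_\omega)_W(u(\omega))\ \text{i.a.e.}\}.$$ 3. Let $I_f^*(v)<\infty$. The following are equivalent: (i) $\omega\mapsto f^*_\omega(v(\omega))$ is integrally measurable with respect to the completion $\mathcal A_\mu$, and $I_f^*(v)=\int f_\omega^*(v(\omega))\,d\bar\mu(\omega)$; (ii) for every $A\in\mathcal A_{a\sigma}$ there is $W\in\mathcal S(X)$ with $f^*_\omega(v(\omega))=\sup_{x\in W}\langle v(\omega),x\rangle-f_\omega(x)$ for a.e. $\omega\in A$. If $\mathcal S_u(X)\neq\emptyset$ for every $u\in R$ (for instance if the elements of $R$ are strongly measurable, or if $\mu$ is $\sigma$-finite), then (i) is also equivalent to the existence of a single $W\in\mathcal S(X)$ with $f^*_\omega(v(\omega))=\sup_{x\in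 W}\langle v(\omega),x\rangle-f_\omega(x)$ i.a.e. If (ii) holds, then for every $u\in R$ with $I_f(u)\in\mathbb R$: $v\in\partial I_f(u)$ if and only if $v(\omega)\in\partial f_\omega(u(\omega))$ i.a.e. -/

import Mathlib

open MeasureTheory TopologicalSpace
open scoped ENNReal

noncomputable section

namespace IntegralConjugate

variable {Ω X : Type*} [MeasurableSpace Ω]

/-! ### Atoms, the σ-ring `𝒜_{aσ}`, integrally almost everywhere -/

/-- An atom of `μ`: a measurable set of positive (possibly infinite) measure, each measurable
subset of which has measure `0` or full measure. -/
def IsMeasureAtom (μ : Measure Ω) (A : Set Ω) : Prop :=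
  MeasurableSet A ∧ 0 < μ A ∧
    ∀ B : Set Ω, MeasurableSet B → B ⊆ A → μ B = 0 ∨ μ B = μ A

/-- The σ-ring of the sets that are the union of countably many atoms and a σ-finite set. -/
def atomSigma (μ : Measure Ω) : Set (Set Ω) :=
  {A | ∃ (C : Set (Set Ω)) (B : Set Ω), C.Countable ∧ (∀ D ∈ C, IsMeasureAtom μ D) ∧
    MeasurableSet B ∧ SigmaFinite (μ.restrict B) ∧ A = ⋃₀ C ∪ B}

/-- `p` holds integrally almost everywhere: the exceptional set meets every set of `atomSigma μ`
in a null set. -/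
def IAE (μ : Measure Ω) (p : Ω → Prop) : Prop :=
  ∀ A ∈ atomSigma μ, ∀ᵐ ω ∂(μ.restrict A), p ω

/-! ### The exhausting integral -/

/-- The exhausting integral of the positive parts of a family `α A`, `A ∈ atomSigma μ`. -/
def exhLIntegralFam (μ : Measure Ω) (α : Set Ω → Ω → EReal) : ℝ≥0∞ :=
  ⨆ A ∈ atomSigma μ, ∫⁻ ω in A, (α A ω).toENNReal ∂μ

open Classical in
/-- The exhausting integral of a family `α A`, `A ∈ atomSigma μ`: the integral of the positive part
minus the integral of the negative part, with the convention `∞ - ∞ = ∞`.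
The families to which this is applied are a.e. measurable on `A`, and there `∫⁻ … ∂μ` is the same
as the integral with respect to the completion of `μ`. -/
def exhIntegralFam (μ : Measure Ω) (α : Set Ω → Ω → EReal) : EReal :=
  if exhLIntegralFam μ α = ∞ then ⊤
  else (exhLIntegralFam μ α : EReal) - (exhLIntegralFam μ (fun A ω => -α A ω) : EReal)

/-- The exhausting integral of a single function. -/
def exhIntegral (μ : Measure Ω) (α : Ω → EReal) : EReal :=
  exhIntegralFam μ (fun _ => α)

/-! ### Essential suprema of arbitrary families -/

/-- `m` is an essential supremum function on `A` of the family `φ i`: an a.e. measurable a.e. upper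
bound of each `φ i` on `A` that lies a.e. below every other one. -/
def IsEssSupOn {ι : Type*} (μ : Measure Ω) (A : Set Ω) (φ : ι → Ω → EReal) (m : Ω → EReal) :
    Prop :=
  AEMeasurable m (μ.restrict A) ∧ (∀ i, ∀ᵐ ω ∂(μ.restrict A), φ i ω ≤ m ω) ∧
    ∀ n : Ω → EReal, AEMeasurable n (μ.restrict A) →
      (∀ i, ∀ᵐ ω ∂(μ.restrict A), φ i ω ≤ n ω) → ∀ᵐ ω ∂(μ.restrict A), m ω ≤ n ω

/-! ### Integral measurability -/

variable [NormedAddCommGroup X] [NormedSpace ℝ X]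

/-- `u` is strongly measurable on every set of `atomSigma μ`. -/
def IntegrallyStronglyMeasurable (μ : Measure Ω) (u : Ω → X) : Prop :=
  ∀ A ∈ atomSigma μ, StronglyMeasurable (fun ω : A => u ω)

/-- `v` is weak* measurable on every set of `atomSigma μ`. -/
def IntegrallyWeakStarMeasurable (μ : Measure Ω) (v : Ω → X →L[ℝ] ℝ) : Prop :=
  ∀ A ∈ atomSigma μ, ∀ x : X, Measurable (fun ω : A => v ω x)

/-- For all `A ∈ atomSigma μ` and all separable `W`, the restriction of the integrand `f` to
`A × W` is measurable for the product of the trace σ-algebra on `A` and the Borel σ-algebra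
of `W`. -/
def IntegrallySeparablyMeasurable [MeasurableSpace X] (μ : Measure Ω) (f : Ω → X → EReal) :
    Prop :=
  ∀ A ∈ atomSigma μ, ∀ W : Set X, IsSeparable W →
    Measurable (fun p : A × W => f (p.1 : Ω) (p.2 : X))

open Classical in
/-- Almost decomposability of a space of functions. A bounded strongly measurable function on the
measurable set `F` is given through its extension by `0`. -/
def AlmostDecomposable (μ : Measure Ω) (R : Set (Ω → X)) : Prop :=
  ∀ u₀ ∈ R, ∀ F : Set Ω, MeasurableSet F → μ F < ∞ → ∀ ε : ℝ≥0∞, 0 < ε →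
    ∀ u₁ : Ω → X, StronglyMeasurable u₁ → (∃ C : ℝ, ∀ ω, ‖u₁ ω‖ ≤ C) →
      ∃ Fε : Set Ω, Fε ⊆ F ∧ MeasurableSet Fε ∧ μ (F \ Fε) < ε ∧ Fε.piecewise u₁ u₀ ∈ R

/-! ### Integral functionals, conjugates, subdifferentials -/

/-- `I_f(u) = ∫ f(ω, u(ω)) dμ(ω)`. -/
def integralFunctional (μ : Measure Ω) (f : Ω → X → EReal) (u : Ω → X) : EReal :=
  exhIntegral μ (fun ω => f ω (u ω))

/-- The pairing `∫ ⟨v(ω), u(ω)⟩ dμ(ω)`. -/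
def pairing (μ : Measure Ω) (u : Ω → X) (v : Ω → X →L[ℝ] ℝ) : EReal :=
  exhIntegral μ (fun ω => ((v ω (u ω) : ℝ) : EReal))

/-- The convex conjugate at `v` of `I_f : R → [-∞, ∞]` with respect to the pairing. -/
def conjugateFunctional (μ : Measure Ω) (f : Ω → X → EReal) (R : Submodule ℝ (Ω → X))
    (v : Ω → X →L[ℝ] ℝ) : EReal :=
  ⨆ u ∈ R, pairing μ u v - integralFunctional μ f u

/-- `sup_{x ∈ W} ⟨x', x⟩ - g(x)`. -/
def conjugateOn (g : X → EReal) (W : Set X) (x' : X →L[ℝ] ℝ) : EReal :=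
  ⨆ x ∈ W, ((x' x : ℝ) : EReal) - g x

/-- The convex conjugate `g*(x') = sup_{x ∈ X} ⟨x', x⟩ - g(x)`. -/
def conjugate (g : X → EReal) (x' : X →L[ℝ] ℝ) : EReal :=
  ⨆ x : X, ((x' x : ℝ) : EReal) - g x

/-- The subdifferential at `x` of the restriction of `g` to `W`, as the set of those `x'` whose
restriction to `W` is a subgradient. It is empty where `g` is not finite. -/
def subdifferentialOn (g : X → EReal) (W : Set X) (x : X) : Set (X →L[ℝ] ℝ) :=
  {x' | x ∈ W ∧ g x ≠ ⊤ ∧ g x ≠ ⊥ ∧ ∀ y ∈ W, g x + ((x' (y - x) : ℝ) : EReal) ≤ g y}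

/-- The Fenchel-Moreau subdifferential at `u ∈ R` of `I_f : R → [-∞, ∞]` with respect to the pairing
of `R` and `S`. It is empty where `I_f` is not finite. -/
def subdifferentialFunctional (μ : Measure Ω) (f : Ω → X → EReal) (R : Submodule ℝ (Ω → X))
    (S : Submodule ℝ (Ω → X →L[ℝ] ℝ)) (u : Ω → X) : Set (Ω → X →L[ℝ] ℝ) :=
  {v | v ∈ S ∧ integralFunctional μ f u ≠ ⊤ ∧ integralFunctional μ f u ≠ ⊥ ∧
    ∀ w ∈ R, integralFunctional μ f u + pairing μ (w - u) v ≤ integralFunctional μ f w}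

/-- The separable sets that almost contain the range of `u`. -/
def separableRange (μ : Measure Ω) (u : Ω → X) : Set (Set X) :=
  {W | IsSeparable W ∧ IAE μ (fun ω => u ω ∈ W)}

end IntegralConjugate

end

noncomputable section

namespace IntegralConjugate

/-! The upper bound for the conjugate is pointwise: `u` in `R` has separable range on each `A` in
`atomSigma μ`, so `⟨v,u⟩ - f(u)` lies below the essential supremum there.

For the lower bound, start from `u` with `I_f(u)` finite; if `I_f(u) = -∞`, the conjugate is `∞`.
Countable unions keep `atomSigma μ` closed, so the relevant exhausting integrals all live on one set
`A`, a carrier (`IsConsistent.exists_isCarrier`). On the σ-finite part of `A`, maximizing the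
integral of a bounded increasing transform yields one separable set that realizes the essential
supremum (`exists_conjugateOn_max_of_sigmaFinite`). Its closure is Polish, so Aumann's theorem
(`exists_measurable_selection`) gives measurable almost maximizers. Cut down to bounded functions on
sets of finite measure, they are grafted onto `u` by almost decomposability, at a cost made harmless
by absolute continuity of the integral (`Admissible.exists_add_le_pairing_sub`). The rest of `A`
carries only the measures `0` and `∞`. There integrable functions vanish, so `⟨v,u⟩ - f(u) ≥ 0`,
while the hypothesis on infinite atoms gives the bound `≤ 0` for the suprema: `u` is already
optimal.

The other assertions follow from equality in integrated inequalities. A subgradient is a `v` at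
which `I_f*(v) ≤ ⟨u,v⟩ - I_f(u)`; both sides are integrals of pointwise ordered integrands, and the
right one is finite, so the integrands agree a.e. (`ae_eq_of_exhIntegralFam_eq`). The same principle
compares `f*(v)` with the supremum over a maximal separable set. To obtain one `W` for all of `Ω`,
the almost range of some `u` is added: off a carrier both `f*(v)` and `⟨v,u⟩ - f(u)` vanish, so `u`
attains the supremum there. -/

/-! ### Measurable selections -/

/-- The points of the Baire space whose first `n` coordinates are bounded by those of `b`. -/
def boundedPrefix (n : ℕ) (b : ℕ → ℕ) : Set (ℕ → ℕ) := {x | ∀ i < n, x i ≤ b i}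

/-- Compactness of the box below `b`: counterexamples, truncated by `b`, subconverge in the box, and
each coordinate is eventually unaffected by the truncation. -/
lemma exists_boundedPrefix_subset (b : ℕ → ℕ) {V : Set (ℕ → ℕ)} (hV : IsOpen V)
    (hb : {x : ℕ → ℕ | ∀ i, x i ≤ b i} ⊆ V) : ∃ n, boundedPrefix n b ⊆ V := by
  by_contra! hcon
  have hK : IsCompact {x : ℕ → ℕ | ∀ i, x i ≤ b i} := by
    have : {x : ℕ → ℕ | ∀ i, x i ≤ b i} = Set.pi Set.univ (fun i => Set.Iic (b i)) := by
      ext x; simp [Pi.le_def]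
    rw [this]
    exact isCompact_univ_pi fun i => (Set.finite_Iic (b i)).isCompact
  have hx : ∀ n, ∃ x ∈ boundedPrefix n b, x ∉ V := fun n => Set.not_subset.1 (hcon n)
  choose x hxb hxV using hx
  obtain ⟨a, ha, φ, hφ, hlim⟩ := hK.tendsto_subseq (x := fun n i => min (x n i) (b i))
    (fun n i => min_le_right _ _)
  have hlim' : Filter.Tendsto (x ∘ φ) Filter.atTop (nhds a) := by
    rw [tendsto_pi_nhds] at hlim ⊢
    intro i
    refine (hlim i).congr' ?_
    filter_upwards [Filter.eventually_gt_atTop i] with n hn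
    exact min_eq_left (hxb (φ n) i (hn.trans_le hφ.le_apply))
  obtain ⟨n, hn⟩ := (hlim'.eventually (hV.mem_nhds (hb ha))).exists
  exact hxV _ hn

/-- The coordinates are bounded one at a time. Continuity from below along increasing unions holds
for arbitrary sets, so the images need not be measurable. -/
lemma exists_forall_lt_measure_image_boundedPrefix {Y : Type*} [MeasurableSpace Y] (ν : Measure Y)
    (h : (ℕ → ℕ) → Y) {c : ℝ≥0∞} (hc : c < ν (Set.range h)) :
    ∃ b : ℕ → ℕ, ∀ n, c < ν (h '' boundedPrefix n b) := by
  have step : ∀ n b, ∃ m, c < ν (h '' boundedPrefix n b) →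
      c < ν (h '' boundedPrefix (n + 1) (Function.update b n m)) := by
    intro n b
    by_cases hcb : c < ν (h '' boundedPrefix n b)
    swap
    · exact ⟨0, fun hh => absurd hh hcb⟩
    have hun : h '' boundedPrefix n b =
        ⋃ m, h '' boundedPrefix (n + 1) (Function.update b n m) := by
      rw [← Set.image_iUnion]
      congr 1
      ext x
      simp only [boundedPrefix, Set.mem_ofPred_eq, Set.mem_iUnion]
      constructor
      · intro hx
        refine ⟨x n, fun i hi => ?_⟩
        rcases Nat.lt_succ_iff_lt_or_eq.1 hi with hi | rfl
        · rw [Function.update_of_ne hi.ne]; exact hx i hi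
        · simp
      · rintro ⟨m, hm⟩ i hi
        have := hm i (hi.trans n.lt_succ_self)
        rwa [Function.update_of_ne hi.ne] at this
    have hmono : Monotone fun m => h '' boundedPrefix (n + 1) (Function.update b n m) := by
      intro m m' hmm
      refine Set.image_mono fun x hx i hi => (hx i hi).trans ?_
      by_cases hin : i = n
      · subst hin; simpa using hmm
      · simp [Function.update_of_ne hin]
    rw [hun, hmono.measure_iUnion] at hcb
    obtain ⟨m, hm⟩ := lt_iSup_iff.1 hcb
    exact ⟨m, fun _ => hm⟩
  choose m hm using step
  let B : ℕ → ℕ → ℕ := fun n => Nat.rec (fun _ => 0) (fun n b => Function.update b n (m n b)) n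
  have hBs : ∀ n, B (n + 1) = Function.update (B n) n (m n (B n)) := fun n => rfl
  have hB : ∀ n, c < ν (h '' boundedPrefix n (B n)) := by
    intro n
    induction n with
    | zero =>
      have : boundedPrefix 0 (B 0) = Set.univ := by ext; simp [boundedPrefix]
      rwa [this, Set.image_univ]
    | succ n ih => rw [hBs]; exact hm n _ ih
  -- Coordinate `i` is fixed at stage `i + 1`, so the diagonal sequence agrees with `B n` below `n`.
  have hstab : ∀ i k, B (i + 1 + k) i = B (i + 1) i := by
    intro i k
    induction k with
    | zero => rfl
    | succ k ih =>
      rw [← ih, ← add_assoc, hBs, Function.update_of_ne (by omega)]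
  refine ⟨fun i => B (i + 1) i, fun n => ?_⟩
  have : boundedPrefix n (fun i => B (i + 1) i) = boundedPrefix n (B n) := by
    ext x
    refine forall₂_congr fun i hi => ?_
    obtain ⟨k, rfl⟩ := Nat.exists_eq_add_of_le (Nat.succ_le_of_lt hi)
    exact (hstab i k).symm ▸ Iff.rfl
  rw [this]
  exact hB n

/-- Inner approximation by images of compact sets, for the continuous images of the Baire space. -/
lemma exists_isCompact_le_measure_image {Y : Type*} [TopologicalSpace Y] [MeasurableSpace Y]
    (ν : Measure Y) [ν.OuterRegular] {h : (ℕ → ℕ) → Y} (hh : Continuous h) {c : ℝ≥0∞}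
    (hc : c < ν (Set.range h)) : ∃ K, IsCompact K ∧ c ≤ ν (h '' K) := by
  obtain ⟨b, hb⟩ := exists_forall_lt_measure_image_boundedPrefix ν h hc
  refine ⟨Set.pi Set.univ (fun i => Set.Iic (b i)),
    isCompact_univ_pi fun i => (Set.finite_Iic (b i)).isCompact, ?_⟩
  rw [Set.measure_eq_iInf_isOpen]
  refine le_iInf₂ fun U hU => le_iInf fun hUo => ?_
  obtain ⟨n, hn⟩ := exists_boundedPrefix_subset b (hUo.preimage hh)
    (fun x hx => hU ⟨x, fun i _ => hx i, rfl⟩)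
  exact (hb n).le.trans (measure_mono (Set.image_subset_iff.2 hn))

/-- Coding the graph of a sequence as a point of the Cantor set linearly orders the Baire space, so
that least elements can be chosen in compact fibres. -/
lemma exists_continuous_injective_baire_real :
    ∃ e : (ℕ → ℕ) → ℝ, Continuous e ∧ Function.Injective e := by
  let d : (ℕ → ℕ) → (ℕ → Bool) := fun x k => decide (x k.unpair.1 = k.unpair.2)
  have hd : Continuous d := continuous_pi fun k =>
    (continuous_of_discreteTopology (f := fun n : ℕ => decide (n = k.unpair.2))).comp
      (continuous_apply k.unpair.1)
  have hdi : Function.Injective d := by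
    intro x y hxy
    ext i
    have := congrFun hxy (Nat.pair i (x i))
    simp only [d, Nat.unpair_pair, decide_true] at this
    exact (of_decide_eq_true this.symm).symm
  exact ⟨fun x => (cantorSetHomeomorphNatToBool.symm (d x) : ℝ),
    continuous_subtype_val.comp (cantorSetHomeomorphNatToBool.symm.continuous.comp hd),
    Subtype.val_injective.comp (cantorSetHomeomorphNatToBool.symm.injective.comp hdi)⟩

/-- In each fibre over `h '' K` take the point with least `e`-value. Sublevel sets of this minimum
are images of compact sets, up to the complement of `h '' K`, where the default value is `0`. -/
lemma exists_measurable_section_of_isCompact {Y : Type*} [TopologicalSpace Y] [T2Space Y]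
    [MeasurableSpace Y] [BorelSpace Y] {h : (ℕ → ℕ) → Y} (hh : Continuous h) {K : Set (ℕ → ℕ)}
    (hK : IsCompact K) : ∃ σ : Y → ℕ → ℕ, Measurable σ ∧ ∀ y ∈ h '' K, h (σ y) = y := by
  classical
  obtain ⟨e, he, hei⟩ := exists_continuous_injective_baire_real
  have hemb : MeasurableEmbedding e := he.measurableEmbedding hei
  obtain ⟨g, hg, hge⟩ := hemb.exists_measurable_extend measurable_id (fun _ => ⟨0⟩)
  let r : Y → ℝ := fun y => if y ∈ h '' K then sInf (e '' (K ∩ h ⁻¹' {y})) else 0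
  have hmin : ∀ y ∈ h '' K, IsLeast (e '' (K ∩ h ⁻¹' {y})) (r y) := by
    rintro y hy
    have hc : IsCompact (e '' (K ∩ h ⁻¹' {y})) :=
      (hK.inter_right (isClosed_singleton.preimage hh)).image he
    have hne : (e '' (K ∩ h ⁻¹' {y})).Nonempty := by
      obtain ⟨x, hx, rfl⟩ := hy
      exact ⟨e x, x, ⟨hx, rfl⟩, rfl⟩
    simp only [r, if_pos hy]
    exact hc.isLeast_sInf hne
  have hr : Measurable r := by
    refine measurable_of_Iic fun c => ?_
    have : r ⁻¹' Set.Iic c = h '' (K ∩ e ⁻¹' Set.Iic c) ∪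
        ((h '' K)ᶜ ∩ {_y | (0 : ℝ) ≤ c}) := by
      ext y
      by_cases hy : y ∈ h '' K
      · simp only [Set.mem_preimage, Set.mem_Iic, Set.mem_union, Set.mem_inter_iff,
          Set.mem_compl_iff, hy, not_true_eq_false, false_and, or_false]
        constructor
        · intro hc
          obtain ⟨x, ⟨hx, hxy⟩, hex⟩ := (hmin y hy).1
          exact ⟨x, ⟨hx, by simpa [hex] using hc⟩, hxy⟩
        · rintro ⟨x, ⟨hx, hxc⟩, hxy⟩
          exact ((hmin y hy).2 ⟨x, ⟨hx, hxy⟩, rfl⟩).trans hxc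
      · have h1 : y ∉ h '' (K ∩ e ⁻¹' Set.Iic c) := fun hy' =>
          hy (Set.image_mono Set.inter_subset_left hy')
        simp only [Set.mem_preimage, Set.mem_Iic, Set.mem_union, h1, false_or,
          Set.mem_inter_iff, Set.mem_compl_iff, hy, not_false_eq_true, true_and,
          Set.mem_ofPred_eq, r, if_false]
    rw [this]
    exact ((hK.inter_right (isClosed_Iic.preimage he)).image hh).measurableSet.union
      ((hK.image hh).measurableSet.compl.inter (MeasurableSet.const _))
  refine ⟨g ∘ r, hg.comp hr, fun y hy => ?_⟩
  obtain ⟨x, ⟨hx, hxy⟩, hex⟩ := (hmin y hy).1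
  have : g (r y) = x := by rw [← hex]; exact congrFun hge x
  simp only [Function.comp_apply, this]
  exact hxy

/-- A continuous map on the Baire space has, almost everywhere on its range, a Borel section. -/
lemma exists_measurable_section_ae {Y : Type*} [TopologicalSpace Y] [T2Space Y]
    [MeasurableSpace Y] [BorelSpace Y] (ν : Measure Y) [IsFiniteMeasure ν] [ν.OuterRegular]
    {h : (ℕ → ℕ) → Y} (hh : Continuous h) :
    ∃ σ : Y → ℕ → ℕ, Measurable σ ∧ ∀ᵐ y ∂ν, y ∈ Set.range h → h (σ y) = y := by
  classical
  by_cases h0 : ν (Set.range h) = 0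
  · refine ⟨fun _ => 0, measurable_const, ?_⟩
    filter_upwards [measure_eq_zero_iff_ae_notMem.1 h0] with y hy hy'
    exact absurd hy' hy
  have hK : ∀ n : ℕ, ∃ K, IsCompact K ∧ ν (Set.range h) - ((n : ℝ≥0∞) + 1)⁻¹ ≤ ν (h '' K) := by
    intro n
    apply exists_isCompact_le_measure_image ν hh
    exact ENNReal.sub_lt_self (measure_ne_top _ _) h0 (by simp)
  choose K hK hKν using hK
  choose s hs hsK using fun n => exists_measurable_section_of_isCompact hh (hK n)
  have hKm : ∀ n, MeasurableSet (h '' K n) := fun n => ((hK n).image hh).measurableSet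
  -- The second alternative makes `Nat.find` total; it only matters on a null part of the range.
  let p : ℕ → Y → Prop := fun n y => y ∈ h '' K n ∨ y ∉ ⋃ n, h '' K n
  have hp : ∀ y, ∃ n, p n y := by
    intro y
    by_cases hy : y ∈ ⋃ n, h '' K n
    · obtain ⟨n, hn⟩ := Set.mem_iUnion.1 hy
      exact ⟨n, Or.inl hn⟩
    · exact ⟨0, Or.inr hy⟩
  have hpm : ∀ n, MeasurableSet {y | p n y} := fun n =>
    (hKm n).union (MeasurableSet.iUnion hKm).compl
  refine ⟨fun y => s (Nat.find (hp y)) y, Measurable.find hs hpm hp, ?_⟩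
  have hnull : ν (Set.range h \ ⋃ n, h '' K n) = 0 := by
    refine le_antisymm (le_of_tendsto_of_tendsto' tendsto_const_nhds
      ENNReal.tendsto_inv_nat_nhds_zero fun n => ?_) bot_le
    calc ν (Set.range h \ ⋃ n, h '' K n) ≤ ν (Set.range h \ h '' K n) :=
          measure_mono (Set.sdiff_subset_sdiff_right (Set.subset_iUnion (fun n => h '' K n) n))
      _ = ν (Set.range h) - ν (h '' K n) :=
          measure_sdiff (Set.image_subset_range _ _) (hKm n).nullMeasurableSet (measure_ne_top _ _)
      _ ≤ ((n : ℝ≥0∞) + 1)⁻¹ := by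
          rw [tsub_le_iff_right, add_comm, ← tsub_le_iff_right]; exact hKν n
      _ ≤ (n : ℝ≥0∞)⁻¹ := ENNReal.inv_le_inv.2 le_self_add
  filter_upwards [measure_eq_zero_iff_ae_notMem.1 hnull] with y hy hyr
  have hyK : y ∈ ⋃ n, h '' K n := by
    by_contra hcon
    exact hy ⟨hyr, hcon⟩
  rcases Nat.find_spec (hp y) with h1 | h1
  · exact hsK _ y h1
  · exact absurd hyK h1

/-- A measurable set of a product depends on its first variable through a map into the Cantor
space. -/
lemma exists_preimage_prodMap_eq {Ω Z : Type*} [MeasurableSpace Ω] [MeasurableSpace Z]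
    {G : Set (Ω × Z)} (hG : MeasurableSet G) :
    ∃ (φ : Ω → ℕ → Bool) (G' : Set ((ℕ → Bool) × Z)), Measurable φ ∧ MeasurableSet G' ∧
      G = Prod.map φ id ⁻¹' G' := by
  classical
  rw [← generateFrom_prod] at hG
  induction G, hG using MeasurableSpace.generateFrom_induction with
  | hC G hG _ =>
    obtain ⟨s, hs, t, ht, rfl⟩ := hG
    refine ⟨fun ω _ => decide (ω ∈ s), {y | y 0 = true} ×ˢ t, ?_, ?_, ?_⟩
    · exact measurable_pi_lambda _ fun _ => measurable_to_bool (by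
        have : (fun ω => decide (ω ∈ s)) ⁻¹' {true} = s := by ext; simp
        rw [this]; exact hs)
    · exact (measurableSet_eq_fun (measurable_pi_apply 0) measurable_const).prod ht
    · ext ⟨ω, z⟩; simp
  | empty => exact ⟨fun _ _ => true, ∅, measurable_const, MeasurableSet.empty, rfl⟩
  | compl G _ ih =>
    obtain ⟨φ, G', hφ, hG', rfl⟩ := ih
    exact ⟨φ, G'ᶜ, hφ, hG'.compl, rfl⟩
  | iUnion G _ ih =>
    choose φ G' hφ hG' hGG using ih
    -- Countably many Cantor-valued maps are interleaved into one by the pairing function.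
    refine ⟨fun ω k => φ k.unpair.1 ω k.unpair.2,
      ⋃ n, Prod.map (fun y k => y (Nat.pair n k)) id ⁻¹' G' n, ?_, ?_, ?_⟩
    · exact measurable_pi_lambda _ fun k => (measurable_pi_apply _).comp (hφ _)
    · refine MeasurableSet.iUnion fun n => ?_
      exact ((measurable_pi_lambda _ fun k => measurable_pi_apply _).prodMap measurable_id) (hG' n)
    · rw [Set.preimage_iUnion]
      refine Set.iUnion_congr fun n => ?_
      rw [hGG n]
      ext ⟨ω, z⟩
      simp

/-- Aumann's selection theorem. -/
theorem exists_measurable_selection {Ω Z : Type*} [MeasurableSpace Ω] (ν : Measure Ω)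
    [IsFiniteMeasure ν] [TopologicalSpace Z] [PolishSpace Z] [MeasurableSpace Z] [BorelSpace Z]
    [Nonempty Z] {G : Set (Ω × Z)} (hG : MeasurableSet G) :
    ∃ s : Ω → Z, Measurable s ∧ ∀ᵐ ω ∂ν, (∃ z, (ω, z) ∈ G) → (ω, s ω) ∈ G := by
  obtain ⟨φ, G', hφ, hG', rfl⟩ := exists_preimage_prodMap_eq hG
  have : PolishSpace Bool := inferInstance
  have : PolishSpace (ℕ → Bool) := inferInstance
  -- The Borel set `G'` is a continuous image of the Baire space; a section of the first coordinate
  -- of this parametrization, composed with its second coordinate, is the selection.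
  have han := hG'.analyticSet
  rw [AnalyticSet] at han
  rcases han with rfl | ⟨g, hg, rfl⟩
  · exact ⟨fun _ => Classical.arbitrary Z, measurable_const, by simp⟩
  · obtain ⟨σ, hσ, hσg⟩ := exists_measurable_section_ae (ν.map φ) (continuous_fst.comp hg)
    refine ⟨fun ω => (g (σ (φ ω))).2, (hg.snd.measurable).comp (hσ.comp hφ), ?_⟩
    filter_upwards [ae_of_ae_map hφ.aemeasurable hσg] with ω hω
    rintro ⟨z, x, hx⟩
    have h1 : (g (σ (φ ω))).1 = φ ω := hω ⟨x, by simp [hx]⟩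
    exact ⟨σ (φ ω), Prod.ext h1 rfl⟩

/-- The measurable projection theorem. -/
theorem nullMeasurableSet_projection {Ω Z : Type*} [MeasurableSpace Ω] (ν : Measure Ω)
    [IsFiniteMeasure ν] [TopologicalSpace Z] [PolishSpace Z] [MeasurableSpace Z] [BorelSpace Z]
    {G : Set (Ω × Z)} (hG : MeasurableSet G) : NullMeasurableSet {ω | ∃ z, (ω, z) ∈ G} ν := by
  rcases isEmpty_or_nonempty Z with hZ | hZ
  · have : {ω : Ω | ∃ z : Z, (ω, z) ∈ G} = ∅ := by ext; simp
    rw [this]; exact MeasurableSet.empty.nullMeasurableSet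
  obtain ⟨s, hs, hsG⟩ := exists_measurable_selection ν hG
  refine ((measurable_id.prodMk hs) hG).nullMeasurableSet.congr ?_
  rw [Filter.eventuallyEq_set]
  filter_upwards [hsG] with ω hω
  exact ⟨fun h => ⟨s ω, h⟩, hω⟩

/-- The supremum over a Polish space of a jointly measurable function is a.e. measurable. -/
theorem aemeasurable_iSup_of_polishSpace {Ω Z : Type*} [MeasurableSpace Ω] (ν : Measure Ω)
    [IsFiniteMeasure ν] [TopologicalSpace Z] [PolishSpace Z] [MeasurableSpace Z] [BorelSpace Z]
    {F : Ω × Z → EReal} (hF : Measurable F) : AEMeasurable (fun ω => ⨆ z, F (ω, z)) ν := by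
  have : NullMeasurable (fun ω => ⨆ z, F (ω, z)) ν := by
    refine measurable_of_Ioi (α := EReal) (δ := NullMeasurableSpace Ω ν) fun c => ?_
    have : (fun ω => ⨆ z, F (ω, z)) ⁻¹' Set.Ioi c = {ω | ∃ z, (ω, z) ∈ F ⁻¹' Set.Ioi c} := by
      ext ω; simp [lt_iSup_iff]
    exact this ▸ nullMeasurableSet_projection ν (hF measurableSet_Ioi)
  exact this.aemeasurable

/-! ### The σ-ring `atomSigma μ` -/

lemma exists_cover_of_sigmaFinite_restrict {Ω : Type*} [MeasurableSpace Ω] {μ : Measure Ω}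
    {B : Set Ω} (hB : MeasurableSet B) (hs : SigmaFinite (μ.restrict B)) :
    ∃ t : ℕ → Set Ω, (∀ n, MeasurableSet (t n)) ∧ (∀ n, μ (t n) < ∞) ∧ B = ⋃ n, t n := by
  refine ⟨fun n => spanningSets (μ.restrict B) n ∩ B,
    fun n => (measurableSet_spanningSets _ n).inter hB, fun n => ?_, ?_⟩
  · rw [← Measure.restrict_apply (measurableSet_spanningSets _ n)]
    exact measure_spanningSets_lt_top _ n
  · rw [← Set.iUnion_inter, iUnion_spanningSets, Set.univ_inter]

lemma sigmaFinite_restrict_of_cover {Ω ι : Type*} [MeasurableSpace Ω] {μ : Measure Ω} [Countable ι]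
    {B : Set Ω} (hB : MeasurableSet B) {t : ι → Set Ω} (ht : ∀ i, μ (t i) < ∞)
    (hBt : B ⊆ ⋃ i, t i) : SigmaFinite (μ.restrict B) := by
  refine Measure.sigmaFinite_of_countable (S := insert Bᶜ (Set.range t))
    ((Set.countable_range t).insert _) ?_ ?_
  · rintro s (rfl | ⟨i, rfl⟩)
    · rw [Measure.restrict_apply hB.compl]; simp
    · exact (Measure.restrict_apply_le _ _).trans_lt (ht i)
  · rw [Set.sUnion_insert, Set.sUnion_range, ← Set.compl_subset_iff_union, compl_compl]
    exact hBt

section atomSigma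

variable {Ω : Type*} [MeasurableSpace Ω] {μ : Measure Ω}

lemma measurableSet_of_mem_atomSigma {A : Set Ω} (hA : A ∈ atomSigma μ) : MeasurableSet A := by
  obtain ⟨C, B, hC, hCa, hB, -, rfl⟩ := hA
  exact (MeasurableSet.sUnion hC fun D hD => (hCa D hD).1).union hB

lemma empty_mem_atomSigma : (∅ : Set Ω) ∈ atomSigma μ :=
  ⟨∅, ∅, Set.countable_empty, by simp, MeasurableSet.empty,
    by rw [Measure.restrict_empty]; infer_instance, by simp⟩

lemma iUnion_mem_atomSigma {A : ℕ → Set Ω} (hA : ∀ n, A n ∈ atomSigma μ) :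
    ⋃ n, A n ∈ atomSigma μ := by
  choose C B hC hCa hB hBs hAe using hA
  choose t _ htf hBt using fun n => exists_cover_of_sigmaFinite_restrict (hB n) (hBs n)
  have hBm : MeasurableSet (⋃ n, B n) := MeasurableSet.iUnion hB
  refine ⟨⋃ n, C n, ⋃ n, B n, Set.countable_iUnion hC, ?_, hBm, ?_, ?_⟩
  · intro D hD
    obtain ⟨n, hn⟩ := Set.mem_iUnion.1 hD
    exact hCa n D hn
  · refine sigmaFinite_restrict_of_cover (t := fun p : ℕ × ℕ => t p.1 p.2) hBm
      (fun p => htf p.1 p.2) ?_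
    refine Set.iUnion_subset fun n => ?_
    rw [hBt n]
    exact Set.iUnion_subset fun k => Set.subset_iUnion (fun p : ℕ × ℕ => t p.1 p.2) (n, k)
  · rw [Set.sUnion_iUnion, ← Set.iUnion_union_distrib]
    exact Set.iUnion_congr hAe

lemma union_mem_atomSigma {A B : Set Ω} (hA : A ∈ atomSigma μ) (hB : B ∈ atomSigma μ) :
    A ∪ B ∈ atomSigma μ := by
  have : A ∪ B = ⋃ n : ℕ, if n = 0 then A else B := by
    ext x
    simp only [Set.mem_union, Set.mem_iUnion]
    constructor
    · rintro (h | h)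
      · exact ⟨0, by simpa using h⟩
      · exact ⟨1, by simpa using h⟩
    · rintro ⟨n, hn⟩
      split_ifs at hn
      · exact Or.inl hn
      · exact Or.inr hn
  rw [this]
  refine iUnion_mem_atomSigma fun n => ?_
  split_ifs
  · exact hA
  · exact hB

/-- Every set of `atomSigma μ` splits into a set on which `μ` is `{0, ∞}`-valued and a σ-finite
set. -/
lemma exists_decomposition_of_mem_atomSigma {A : Set Ω} (hA : A ∈ atomSigma μ) :
    ∃ D B : Set Ω, MeasurableSet D ∧ MeasurableSet B ∧ Disjoint D B ∧ A = D ∪ B ∧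
      SigmaFinite (μ.restrict B) ∧ ∀ E, MeasurableSet E → E ⊆ D → μ E = 0 ∨ μ E = ∞ := by
  obtain ⟨C, B, hC, hCa, hB, hBs, rfl⟩ := hA
  have hCm : ∀ D ∈ C, MeasurableSet D := fun D hD => (hCa D hD).1
  obtain ⟨t, htm, htf, hBt⟩ := exists_cover_of_sigmaFinite_restrict hB hBs
  -- Atoms of finite measure go into the σ-finite part, so only infinite atoms remain for the other
  -- one.
  let Cf : Set (Set Ω) := {D ∈ C | μ D < ∞}
  let Ci : Set (Set Ω) := {D ∈ C | μ D = ∞}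
  have hCf : Cf.Countable := hC.mono fun D hD => hD.1
  have hCi : Ci.Countable := hC.mono fun D hD => hD.1
  have hB' : MeasurableSet (⋃₀ Cf ∪ B) :=
    (MeasurableSet.sUnion hCf fun D hD => hCm D hD.1).union hB
  have hCim : MeasurableSet (⋃₀ Ci) := MeasurableSet.sUnion hCi fun D hD => hCm D hD.1
  refine ⟨⋃₀ Ci \ (⋃₀ Cf ∪ B), ⋃₀ Cf ∪ B, hCim.diff hB', hB', Set.disjoint_sdiff_left, ?_, ?_, ?_⟩
  · rw [Set.sdiff_union_self, ← Set.union_assoc, ← Set.sUnion_union]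
    congr 2
    ext D
    simp only [Ci, Cf, Set.mem_union, Set.mem_ofPred_eq]
    constructor
    · intro h
      rcases eq_or_ne (μ D) ∞ with h' | h'
      · exact Or.inl ⟨h, h'⟩
      · exact Or.inr ⟨h, h'.lt_top⟩
    · rintro (h | h) <;> exact h.1
  · have := hCf.to_subtype
    refine sigmaFinite_restrict_of_cover (ι := Cf ⊕ ℕ) hB'
      (t := Sum.elim (fun D => (D : Set Ω)) t) ?_ ?_
    · rintro (D | n)
      · exact D.2.2
      · exact htf n
    · rintro x (⟨D, hD, hx⟩ | hx)
      · exact Set.mem_iUnion.2 ⟨Sum.inl ⟨D, hD⟩, hx⟩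
      · rw [hBt] at hx
        obtain ⟨n, hn⟩ := Set.mem_iUnion.1 hx
        exact Set.mem_iUnion.2 ⟨Sum.inr n, hn⟩
  · intro E hE hED
    by_contra! hcon
    refine hcon.1 ?_
    have hsub : E ⊆ ⋃ D ∈ Ci, E ∩ D := by
      intro x hx
      obtain ⟨D, hD, hxD⟩ := (hED hx).1
      exact Set.mem_biUnion hD ⟨hx, hxD⟩
    refine measure_mono_null hsub ((measure_biUnion_null_iff hCi).2 fun D hD => ?_)
    rcases (hCa D hD.1).2.2 (E ∩ D) (hE.inter (hCm D hD.1)) Set.inter_subset_right with h | h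
    · exact h
    · rw [hD.2] at h
      exact absurd (measure_mono_top Set.inter_subset_left h) hcon.2

/-- By Markov's inequality each set `{p ≥ 1/(n+1)}` has finite measure, and inside `D` this means
measure zero. -/
lemma ae_eq_zero_of_lintegral_ne_top {D : Set Ω} (hD : MeasurableSet D)
    (hDμ : ∀ E, MeasurableSet E → E ⊆ D → μ E = 0 ∨ μ E = ∞) {p : Ω → ℝ≥0∞}
    (hp : AEMeasurable p (μ.restrict D)) (hpi : ∫⁻ ω in D, p ω ∂μ ≠ ∞) :
    ∀ᵐ ω ∂(μ.restrict D), p ω = 0 := by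
  rw [lintegral_congr_ae hp.ae_eq_mk] at hpi
  have key : ∀ n : ℕ, ∀ᵐ ω ∂(μ.restrict D), ¬ ((n : ℝ≥0∞) + 1)⁻¹ ≤ hp.mk p ω := by
    intro n
    refine (measure_eq_zero_iff_ae_notMem (s := {ω | ((n : ℝ≥0∞) + 1)⁻¹ ≤ hp.mk p ω})).1 ?_
    have hm : MeasurableSet {ω | ((n : ℝ≥0∞) + 1)⁻¹ ≤ hp.mk p ω} :=
      measurableSet_le measurable_const hp.measurable_mk
    have hle := mul_meas_ge_le_lintegral₀ hp.measurable_mk.aemeasurable ((n : ℝ≥0∞) + 1)⁻¹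
      (μ := μ.restrict D)
    rw [Measure.restrict_apply hm] at hle ⊢
    refine (hDμ _ (hm.inter hD) Set.inter_subset_right).resolve_right fun htop => ?_
    rw [htop, ENNReal.mul_top (by simp)] at hle
    exact hpi (top_le_iff.1 hle)
  filter_upwards [hp.ae_eq_mk, ae_all_iff.2 key] with ω h1 h2
  rw [h1]
  by_contra hne
  obtain ⟨n, hn⟩ := ENNReal.exists_inv_nat_lt hne
  exact h2 n ((ENNReal.inv_le_inv.2 le_self_add).trans hn.le)

end atomSigma

/-! ### The extended Lebesgue integral -/

section extIntegral

variable {Ω : Type*} [MeasurableSpace Ω]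

open Classical in
/-- The extended Lebesgue integral, with the convention `∞ - ∞ = ∞`. -/
def extIntegral (ν : Measure Ω) (g : Ω → EReal) : EReal :=
  if ∫⁻ ω, (g ω).toENNReal ∂ν = ∞ then ⊤
  else ((∫⁻ ω, (g ω).toENNReal ∂ν : ℝ≥0∞) : EReal) - ((∫⁻ ω, (-g ω).toENNReal ∂ν : ℝ≥0∞) : EReal)

variable {ν : Measure Ω} {g h : Ω → EReal}

lemma extIntegral_congr (hgh : g =ᵐ[ν] h) : extIntegral ν g = extIntegral ν h := by
  have h1 : ∫⁻ ω, (g ω).toENNReal ∂ν = ∫⁻ ω, (h ω).toENNReal ∂ν :=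
    lintegral_congr_ae (hgh.mono fun ω hω => by simp only [hω])
  have h2 : ∫⁻ ω, (-g ω).toENNReal ∂ν = ∫⁻ ω, (-h ω).toENNReal ∂ν :=
    lintegral_congr_ae (hgh.mono fun ω hω => by simp only [hω])
  rw [extIntegral, extIntegral, h1, h2]

lemma extIntegral_mono (hgh : g ≤ᵐ[ν] h) : extIntegral ν g ≤ extIntegral ν h := by
  have h1 : ∫⁻ ω, (g ω).toENNReal ∂ν ≤ ∫⁻ ω, (h ω).toENNReal ∂ν :=
    lintegral_mono_ae (hgh.mono fun ω hω => EReal.toENNReal_le_toENNReal hω)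
  have h2 : ∫⁻ ω, (-h ω).toENNReal ∂ν ≤ ∫⁻ ω, (-g ω).toENNReal ∂ν :=
    lintegral_mono_ae (hgh.mono fun ω hω =>
      EReal.toENNReal_le_toENNReal (EReal.neg_le_neg_iff.2 hω))
  rw [extIntegral, extIntegral]
  split_ifs with hg hh hh
  · exact le_rfl
  · exact absurd (top_le_iff.1 (hg ▸ h1)) hh
  · exact le_top
  · exact EReal.sub_le_sub (EReal.coe_ennreal_le_coe_ennreal_iff.2 h1)
      (EReal.coe_ennreal_le_coe_ennreal_iff.2 h2)

lemma extIntegral_eq_top_iff : extIntegral ν g = ⊤ ↔ ∫⁻ ω, (g ω).toENNReal ∂ν = ∞ := by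
  rw [extIntegral]
  split_ifs with hg
  · simp [hg]
  · refine iff_of_false ?_ hg
    rw [← EReal.coe_ennreal_toReal hg]
    intro h
    induction hx : ((∫⁻ ω, (-g ω).toENNReal ∂ν : ℝ≥0∞) : EReal) with
    | bot => exact EReal.coe_ennreal_ne_bot _ hx
    | coe x => rw [hx, ← EReal.coe_sub] at h; exact EReal.coe_ne_top _ h
    | top => rw [hx] at h; simp at h

lemma extIntegral_ne_bot_iff (hg : ∫⁻ ω, (g ω).toENNReal ∂ν ≠ ∞) :
    extIntegral ν g ≠ ⊥ ↔ ∫⁻ ω, (-g ω).toENNReal ∂ν ≠ ∞ := by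
  rw [extIntegral, if_neg hg, ← EReal.coe_ennreal_toReal hg]
  constructor
  · intro h h'
    rw [h'] at h
    simp at h
  · intro h
    rw [← EReal.coe_ennreal_toReal h, ← EReal.coe_sub]
    exact EReal.coe_ne_bot _

lemma extIntegral_coe {p : Ω → ℝ} (hp : Integrable p ν) :
    extIntegral ν (fun ω => (p ω : EReal)) = ((∫ ω, p ω ∂ν : ℝ) : EReal) := by
  have h1 : ∫⁻ ω, ((p ω : EReal)).toENNReal ∂ν ≠ ∞ := hp.lintegral_lt_top.ne
  have h2 : ∫⁻ ω, (-(p ω : EReal)).toENNReal ∂ν ≠ ∞ := hp.neg.lintegral_lt_top.ne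
  rw [extIntegral, if_neg h1, ← EReal.coe_ennreal_toReal h1, ← EReal.coe_ennreal_toReal h2,
    ← EReal.coe_sub, integral_eq_lintegral_pos_part_sub_lintegral_neg_part hp]
  rfl

/-- A function with finite extended integral is a.e. equal to an integrable real function. -/
lemma exists_integrable_of_extIntegral_finite (hg : AEMeasurable g ν) (ht : extIntegral ν g ≠ ⊤)
    (hb : extIntegral ν g ≠ ⊥) :
    ∃ p : Ω → ℝ, Integrable p ν ∧ g =ᵐ[ν] fun ω => (p ω : EReal) := by
  have h1 : ∫⁻ ω, (g ω).toENNReal ∂ν ≠ ∞ := fun h => ht (extIntegral_eq_top_iff.2 h)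
  have h2 := (extIntegral_ne_bot_iff h1).1 hb
  have hfin : g =ᵐ[ν] fun ω => ((g ω).toReal : EReal) := by
    filter_upwards [ae_lt_top' hg.ereal_toENNReal h1, ae_lt_top' hg.neg.ereal_toENNReal h2]
      with ω hω1 hω2
    refine (EReal.coe_toReal (EReal.toENNReal_ne_top_iff.1 hω1.ne) fun hbot => ?_).symm
    simp [hbot] at hω2
  refine ⟨fun ω => (g ω).toReal, ⟨hg.ereal_toReal.aestronglyMeasurable, ?_⟩, hfin⟩
  rw [HasFiniteIntegral]
  calc ∫⁻ ω, ‖(g ω).toReal‖ₑ ∂ν ≤ ∫⁻ ω, ((g ω).toENNReal + (-g ω).toENNReal) ∂ν := by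
        refine lintegral_mono_ae (hfin.mono fun ω hω => ?_)
        rw [hω]
        simp only [EReal.toReal_coe, ← EReal.coe_neg, EReal.real_coe_toENNReal]
        rw [Real.enorm_eq_ofReal_abs]
        rcases le_total 0 (g ω).toReal with h | h
        · rw [abs_of_nonneg h]; exact le_self_add
        · rw [abs_of_nonpos h]; exact le_add_self
    _ = _ := lintegral_add_left' hg.ereal_toENNReal _
    _ < ∞ := ENNReal.add_lt_top.2 ⟨h1.lt_top, h2.lt_top⟩

/-- Finiteness reduces this to integrable real functions, where an ordered pair with equal integrals
coincides a.e. -/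
lemma ae_eq_of_extIntegral_eq (hg : AEMeasurable g ν) (hh : AEMeasurable h ν) (hgh : g ≤ᵐ[ν] h)
    (heq : extIntegral ν g = extIntegral ν h) (ht : extIntegral ν g ≠ ⊤)
    (hb : extIntegral ν g ≠ ⊥) : g =ᵐ[ν] h := by
  obtain ⟨p, hp, hgp⟩ := exists_integrable_of_extIntegral_finite hg ht hb
  obtain ⟨q, hq, hhq⟩ := exists_integrable_of_extIntegral_finite hh (heq ▸ ht) (heq ▸ hb)
  rw [extIntegral_congr hgp, extIntegral_congr hhq, extIntegral_coe hp, extIntegral_coe hq,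
    EReal.coe_eq_coe_iff] at heq
  have hpq : p ≤ᵐ[ν] q := by
    filter_upwards [hgp, hhq, hgh] with ω h1 h2 h3
    rw [h1, h2] at h3
    exact EReal.coe_le_coe_iff.1 h3
  have := (integral_eq_iff_of_ae_le hp hq hpq).1 heq
  filter_upwards [hgp, hhq, this] with ω h1 h2 h3
  rw [h1, h2, h3]

lemma extIntegral_coe_sub {p : Ω → ℝ} (hp : Integrable p ν) (hh : AEMeasurable h ν)
    (ht : extIntegral ν h ≠ ⊤) :
    extIntegral ν (fun ω => (p ω : EReal) - h ω) =
      ((∫ ω, p ω ∂ν : ℝ) : EReal) - extIntegral ν h := by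
  by_cases hb : extIntegral ν h = ⊥
  · have h1 : ∫⁻ ω, (h ω).toENNReal ∂ν ≠ ∞ := fun h => ht (extIntegral_eq_top_iff.2 h)
    have h2 : ∫⁻ ω, (-h ω).toENNReal ∂ν = ∞ := by
      by_contra h2
      exact (extIntegral_ne_bot_iff h1).2 h2 hb
    rw [hb, EReal.coe_sub_bot, extIntegral_eq_top_iff]
    by_contra h3
    -- If `(p - h)⁺` had finite integral, then so would `h⁻ ≤ (p - h)⁺ + p⁻`.
    have hle : ∫⁻ ω, (-h ω).toENNReal ∂ν ≤
        ∫⁻ ω, (((p ω : EReal) - h ω).toENNReal + ENNReal.ofReal (-p ω)) ∂ν := by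
      refine lintegral_mono fun ω => ?_
      have : -h ω ≤ ((p ω : EReal) - h ω) + ((-p ω : ℝ) : EReal) := by
        induction h ω with
        | bot => simp
        | coe x => norm_cast; linarith
        | top => simp
      calc (-h ω).toENNReal ≤ (((p ω : EReal) - h ω) + ((-p ω : ℝ) : EReal)).toENNReal :=
            EReal.toENNReal_le_toENNReal this
        _ ≤ _ := EReal.toENNReal_add_le
    have hpm : AEMeasurable (fun ω => ENNReal.ofReal (-p ω)) ν :=
      hp.aestronglyMeasurable.aemeasurable.neg.ennreal_ofReal
    rw [h2, lintegral_add_right' _ hpm,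
      top_le_iff, ENNReal.add_eq_top] at hle
    exact hle.elim h3 hp.neg.lintegral_lt_top.ne
  · obtain ⟨q, hq, hhq⟩ := exists_integrable_of_extIntegral_finite hh ht hb
    rw [extIntegral_congr hhq, extIntegral_coe hq, ← EReal.coe_sub, ← integral_sub hp hq,
      ← extIntegral_coe (p := fun ω => p ω - q ω) (hp.sub hq)]
    refine extIntegral_congr (hhq.mono fun ω hω => ?_)
    simp [hω]

/-- An integrable minorant turns a bound on a signed integral into one on the nonnegative excess,
which simple functions approximate from below. -/
lemma extIntegral_le_add_lintegral_sub {p : Ω → ℝ} (hp : Integrable p ν) (hh : AEMeasurable h ν)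
    (hph : ∀ᵐ ω ∂ν, (p ω : EReal) ≤ h ω) :
    extIntegral ν h ≤ ((∫ ω, p ω ∂ν : ℝ) : EReal) +
      ((∫⁻ ω, (h ω - (p ω : EReal)).toENNReal ∂ν : ℝ≥0∞) : EReal) := by
  by_cases hq : ∫⁻ ω, (h ω - (p ω : EReal)).toENNReal ∂ν = ∞
  · rw [hq]; simp
  have hqm : AEMeasurable (fun ω => (h ω - (p ω : EReal)).toENNReal) ν :=
    (hh.sub hp.aestronglyMeasurable.aemeasurable.coe_real_ereal).ereal_toENNReal
  have hqi := integrable_toReal_of_lintegral_ne_top hqm hq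
  have heq : h =ᵐ[ν] fun ω => ((p ω + (h ω - (p ω : EReal)).toENNReal.toReal : ℝ) : EReal) := by
    filter_upwards [hph, ae_lt_top' hqm hq] with ω h1 h2
    have h3 : 0 ≤ h ω - (p ω : EReal) := by
      rw [EReal.sub_nonneg (by simp) (by simp)]; exact h1
    rw [EReal.toReal_toENNReal h3]
    have h4 := EReal.toENNReal_ne_top_iff.1 h2.ne
    induction hx : h ω with
    | bot => simp [hx] at h1
    | coe x => rw [← EReal.coe_sub, EReal.toReal_coe]; norm_cast; ring
    | top => simp [hx] at h4
  rw [extIntegral_congr heq, extIntegral_coe (p := fun ω => p ω + (h ω - (p ω : EReal)).toENNReal.toReal)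
    (hp.add hqi), integral_add hp hqi,
    integral_toReal hqm (ae_lt_top' hqm hq), EReal.coe_add, EReal.coe_ennreal_toReal hq]

end extIntegral

/-! ### Carriers of exhausting integrals -/

/-- Exhaustion principle: an upper bound for a maximizing sequence attains the supremum. It serves
both for carriers and for maximal separable sets. -/
lemma exists_forall_le_of_forall_seq {ι : Type*} [Nonempty ι] (F : ι → ℝ≥0∞)
    (h : ∀ x : ℕ → ι, ∃ j, ∀ n, F (x n) ≤ F j) : ∃ j, ∀ i, F i ≤ F j := by
  obtain ⟨u, -, hu, huF⟩ := exists_seq_tendsto_sSup (Set.range_nonempty F) (OrderTop.bddAbove _)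
  choose x hx using huF
  obtain ⟨j, hj⟩ := h x
  exact ⟨j, fun i => (le_sSup (Set.mem_range_self i)).trans
    (le_of_tendsto' hu fun n => (hx n).symm.le.trans (hj n))⟩

section carrier

variable {Ω : Type*} [MeasurableSpace Ω] {μ : Measure Ω} {α : Set Ω → Ω → EReal}

/-- The members of the family `α` agree a.e. on common sets of `atomSigma μ`. -/
def IsConsistent (μ : Measure Ω) (α : Set Ω → Ω → EReal) : Prop :=
  ∀ A ∈ atomSigma μ, ∀ B ∈ atomSigma μ, A ⊆ B → α A =ᵐ[μ.restrict A] α B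

lemma isConsistent_const (α : Ω → EReal) : IsConsistent μ (fun _ => α) :=
  fun _ _ _ _ _ => Filter.EventuallyEq.rfl

/-- The exhausting integral of `α` is the integral over every set of `atomSigma μ` that
contains `A`. -/
def IsCarrier (μ : Measure Ω) (α : Set Ω → Ω → EReal) (A : Set Ω) : Prop :=
  A ∈ atomSigma μ ∧ ∀ B ∈ atomSigma μ, A ⊆ B →
    exhLIntegralFam μ α = ∫⁻ ω in B, (α B ω).toENNReal ∂μ ∧
    exhLIntegralFam μ (fun A ω => -α A ω) = ∫⁻ ω in B, (-α B ω).toENNReal ∂μ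

lemma setLIntegral_le_exhLIntegralFam (α : Set Ω → Ω → EReal) {A : Set Ω} (hA : A ∈ atomSigma μ) :
    ∫⁻ ω in A, (α A ω).toENNReal ∂μ ≤ exhLIntegralFam μ α :=
  le_iSup₂ (f := fun A (_ : A ∈ atomSigma μ) => ∫⁻ ω in A, (α A ω).toENNReal ∂μ) A hA

lemma IsConsistent.setLIntegral_mono (hα : IsConsistent μ α) {A B : Set Ω} (hA : A ∈ atomSigma μ)
    (hB : B ∈ atomSigma μ) (hAB : A ⊆ B) :
    ∫⁻ ω in A, (α A ω).toENNReal ∂μ ≤ ∫⁻ ω in B, (α B ω).toENNReal ∂μ := by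
  rw [lintegral_congr_ae ((hα A hA B hB hAB).mono fun ω hω => by
    simp only [hω] : (fun ω => (α A ω).toENNReal) =ᵐ[μ.restrict A] fun ω => (α B ω).toENNReal)]
  exact lintegral_mono_set hAB

lemma IsConsistent.neg (hα : IsConsistent μ α) : IsConsistent μ (fun A ω => -α A ω) :=
  fun A hA B hB hAB => (hα A hA B hB hAB).mono fun ω hω => by simp only [hω]

/-- Integrals of positive parts grow with the set, and the union of a sequence stays in `atomSigma
μ`, so the supremum is attained. -/
lemma IsConsistent.exists_exhLIntegralFam_eq (hα : IsConsistent μ α) :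
    ∃ A ∈ atomSigma μ, ∀ B ∈ atomSigma μ, A ⊆ B →
      exhLIntegralFam μ α = ∫⁻ ω in B, (α B ω).toENNReal ∂μ := by
  have : Nonempty (atomSigma μ) := ⟨⟨∅, empty_mem_atomSigma⟩⟩
  obtain ⟨A, hA⟩ := exists_forall_le_of_forall_seq
    (fun A : atomSigma μ => ∫⁻ ω in A, (α A ω).toENNReal ∂μ) (fun x =>
      ⟨⟨⋃ n, x n, iUnion_mem_atomSigma fun n => (x n).2⟩, fun n =>
        hα.setLIntegral_mono (x n).2 (iUnion_mem_atomSigma fun n => (x n).2)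
          (Set.subset_iUnion (fun n => (x n : Set Ω)) n)⟩)
  refine ⟨A, A.2, fun B hB hAB => le_antisymm ?_ (setLIntegral_le_exhLIntegralFam α hB)⟩
  exact iSup₂_le fun C hC => (hA ⟨C, hC⟩).trans (hα.setLIntegral_mono A.2 hB hAB)

lemma IsConsistent.exists_isCarrier (hα : IsConsistent μ α) : ∃ A, IsCarrier μ α A := by
  obtain ⟨A, hA, hAα⟩ := hα.exists_exhLIntegralFam_eq
  obtain ⟨B, hB, hBα⟩ := hα.neg.exists_exhLIntegralFam_eq
  exact ⟨A ∪ B, union_mem_atomSigma hA hB, fun C hC hABC =>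
    ⟨hAα C hC (Set.subset_union_left.trans hABC), hBα C hC (Set.subset_union_right.trans hABC)⟩⟩

lemma IsCarrier.mono {A B : Set Ω} (h : IsCarrier μ α A) (hB : B ∈ atomSigma μ) (hAB : A ⊆ B) :
    IsCarrier μ α B :=
  ⟨hB, fun C hC hBC => h.2 C hC (hAB.trans hBC)⟩

lemma IsCarrier.exhIntegralFam_eq {A : Set Ω} (h : IsCarrier μ α A) :
    exhIntegralFam μ α = extIntegral (μ.restrict A) (α A) := by
  obtain ⟨h1, h2⟩ := h.2 A h.1 subset_rfl
  rw [exhIntegralFam, extIntegral, h1, h2]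

lemma IsCarrier.exhIntegral_eq {α : Ω → EReal} {A : Set Ω} (h : IsCarrier μ (fun _ => α) A) :
    exhIntegral μ α = extIntegral (μ.restrict A) α :=
  h.exhIntegralFam_eq

lemma exhLIntegralFam_ne_top (hα : IsConsistent μ α) (ht : exhIntegralFam μ α ≠ ⊤) :
    exhLIntegralFam μ α ≠ ∞ := by
  obtain ⟨A, hA⟩ := hα.exists_isCarrier
  rw [hA.exhIntegralFam_eq, Ne, extIntegral_eq_top_iff, ← (hA.2 A hA.1 subset_rfl).1] at ht
  exact ht

lemma exhLIntegralFam_neg_ne_top (hα : IsConsistent μ α) (ht : exhIntegralFam μ α ≠ ⊤)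
    (hb : exhIntegralFam μ α ≠ ⊥) : exhLIntegralFam μ (fun A ω => -α A ω) ≠ ∞ := by
  obtain ⟨A, hA⟩ := hα.exists_isCarrier
  rw [hA.exhIntegralFam_eq, Ne, extIntegral_eq_top_iff] at ht
  rw [hA.exhIntegralFam_eq, extIntegral_ne_bot_iff ht, ← (hA.2 A hA.1 subset_rfl).2] at hb
  exact hb

lemma extIntegral_restrict_ne_top (hα : IsConsistent μ α) (ht : exhIntegralFam μ α ≠ ⊤)
    {A : Set Ω} (hA : A ∈ atomSigma μ) : extIntegral (μ.restrict A) (α A) ≠ ⊤ := by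
  rw [Ne, extIntegral_eq_top_iff]
  exact ne_top_of_le_ne_top (exhLIntegralFam_ne_top hα ht) (setLIntegral_le_exhLIntegralFam α hA)

lemma extIntegral_restrict_ne_bot (hα : IsConsistent μ α) (ht : exhIntegralFam μ α ≠ ⊤)
    (hb : exhIntegralFam μ α ≠ ⊥) {A : Set Ω} (hA : A ∈ atomSigma μ) :
    extIntegral (μ.restrict A) (α A) ≠ ⊥ := by
  have h1 := extIntegral_restrict_ne_top hα ht hA
  rw [Ne, extIntegral_eq_top_iff] at h1
  rw [extIntegral_ne_bot_iff h1]
  exact ne_top_of_le_ne_top (exhLIntegralFam_neg_ne_top hα ht hb)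
    (setLIntegral_le_exhLIntegralFam (fun A ω => -α A ω) hA)

lemma setLIntegral_sdiff_eq_zero_of_le {A B : Set Ω} {p : Ω → ℝ≥0∞} (hA : MeasurableSet A)
    (hAB : A ⊆ B) (hle : ∫⁻ ω in B, p ω ∂μ ≤ ∫⁻ ω in A, p ω ∂μ) (hp : ∫⁻ ω in A, p ω ∂μ ≠ ∞) :
    ∫⁻ ω in B \ A, p ω ∂μ = 0 := by
  have h := lintegral_inter_add_sdiff p B hA (μ := μ)
  rw [Set.inter_eq_self_of_subset_right hAB] at h
  rw [← h] at hle
  exact le_antisymm ((ENNReal.add_le_add_iff_left hp).1 (by simpa using hle)) bot_le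

/-- Passing from `A` to `B` adds nothing to the finite integrals of the positive and negative parts,
so both vanish a.e. on `B \ A`. -/
lemma IsCarrier.ae_eq_zero {A B : Set Ω} (h : IsCarrier μ α A) (hα : IsConsistent μ α)
    (ht : exhIntegralFam μ α ≠ ⊤) (hb : exhIntegralFam μ α ≠ ⊥) (hB : B ∈ atomSigma μ)
    (hAB : A ⊆ B) (hm : AEMeasurable (α B) (μ.restrict B)) :
    ∀ᵐ ω ∂(μ.restrict B), ω ∉ A → α B ω = 0 := by
  have hAm := measurableSet_of_mem_atomSigma h.1
  have hBm := measurableSet_of_mem_atomSigma hB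
  have aux : ∀ {β : Set Ω → Ω → EReal}, IsConsistent μ β → exhLIntegralFam μ β ≠ ∞ →
      exhLIntegralFam μ β = ∫⁻ ω in A, (β A ω).toENNReal ∂μ →
      exhLIntegralFam μ β = ∫⁻ ω in B, (β B ω).toENNReal ∂μ →
      AEMeasurable (β B) (μ.restrict B) →
      ∀ᵐ ω ∂(μ.restrict (B \ A)), (β B ω).toENNReal = 0 := by
    intro β hβ hfin h1 h2 hm
    have h3 : ∫⁻ ω in A, (β A ω).toENNReal ∂μ = ∫⁻ ω in A, (β B ω).toENNReal ∂μ :=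
      lintegral_congr_ae ((hβ A h.1 B hB hAB).mono fun ω hω => by simp only [hω])
    have h4 := setLIntegral_sdiff_eq_zero_of_le (p := fun ω => (β B ω).toENNReal) hAm hAB
      (by rw [← h2, ← h3, ← h1]) (by rw [← h3, ← h1]; exact hfin)
    rw [lintegral_eq_zero_iff' (hm.mono_set Set.sdiff_subset).ereal_toENNReal] at h4
    exact h4
  have h1 := aux hα (exhLIntegralFam_ne_top hα ht) (h.2 A h.1 subset_rfl).1 (h.2 B hB hAB).1 hm
  have h2 := aux hα.neg (exhLIntegralFam_neg_ne_top hα ht hb) (h.2 A h.1 subset_rfl).2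
    (h.2 B hB hAB).2 hm.neg
  rw [ae_restrict_iff' (hBm.diff hAm)] at h1 h2
  rw [ae_restrict_iff' hBm]
  filter_upwards [h1, h2] with ω h1 h2 hωB hωA
  have h1 := EReal.toENNReal_eq_zero_iff.1 (h1 ⟨hωB, hωA⟩)
  have h2 := EReal.toENNReal_eq_zero_iff.1 (h2 ⟨hωB, hωA⟩)
  exact le_antisymm h1 (by simpa using EReal.neg_le_neg_iff.1 (by simpa using h2 : _ ≤ -(0 : EReal)))

end carrier

/-! ### Measurability of the integrands -/

section conjugateOn

variable {X : Type*} [NormedAddCommGroup X] [NormedSpace ℝ X] {W : Set X}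

lemma conjugateOn_mono (g : X → EReal) {W W' : Set X} (h : W ⊆ W') (x' : X →L[ℝ] ℝ) :
    conjugateOn g W x' ≤ conjugateOn g W' x' :=
  biSup_mono fun _ hx => h hx

lemma le_conjugateOn (g : X → EReal) {x : X} (hx : x ∈ W) (x' : X →L[ℝ] ℝ) :
    ((x' x : ℝ) : EReal) - g x ≤ conjugateOn g W x' :=
  le_iSup₂ (f := fun x (_ : x ∈ W) => ((x' x : ℝ) : EReal) - g x) x hx

lemma conjugateOn_le_conjugate (g : X → EReal) (x' : X →L[ℝ] ℝ) :
    conjugateOn g W x' ≤ conjugate g x' :=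
  iSup_mono fun _ => iSup_le fun _ => le_rfl

end conjugateOn

lemma polishSpace_of_isClosed_of_isSeparable {X : Type*} [NormedAddCommGroup X]
    [CompleteSpace X] {W : Set X} (hWc : IsClosed W)
    (hW : IsSeparable W) : PolishSpace W := by
  have := hW.separableSpace
  have : SecondCountableTopology W := UniformSpace.secondCountable_of_separable W
  have : CompleteSpace W := hWc.isComplete.completeSpace_coe
  infer_instance

/-- The range of `u` on `A` is a separable set, and measurability on its product with `A` suffices.
-/
lemma measurable_comp_of_prod {Ω X β : Type*} [MeasurableSpace Ω]
    [NormedAddCommGroup X] [MeasurableSpace X] [BorelSpace X] [MeasurableSpace β] {A : Set Ω}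
    {F : Ω → X → β}
    (hF : ∀ W : Set X, IsSeparable W → Measurable (fun p : A × W => F (p.1 : Ω) (p.2 : X)))
    {u : Ω → X} (hu : StronglyMeasurable (fun ω : A => u ω)) :
    Measurable (fun ω : A => F ω (u ω)) := by
  have h1 : Measurable (fun ω : A => (⟨u ω, Set.mem_range_self ω⟩ :
      Set.range (fun ω : A => u ω))) := hu.measurable.subtype_mk
  exact (hF _ hu.isSeparable_range).comp (measurable_id.prodMk h1)

lemma aemeasurable_integrand {Ω X : Type*} [MeasurableSpace Ω] {μ : Measure Ω}
    [NormedAddCommGroup X] [MeasurableSpace X] [BorelSpace X] {f : Ω → X → EReal} {A : Set Ω}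
    (hf : IntegrallySeparablyMeasurable μ f)
    {u : Ω → X}
    (hu : IntegrallyStronglyMeasurable μ u) (hA : A ∈ atomSigma μ) :
    AEMeasurable (fun ω => f ω (u ω)) (μ.restrict A) :=
  aemeasurable_restrict_of_measurable_subtype (measurableSet_of_mem_atomSigma hA)
    (measurable_comp_of_prod (fun W hW => hf A hA W hW) (hu A hA))

section measurability

variable {Ω X : Type*} [MeasurableSpace Ω] {μ : Measure Ω} [NormedAddCommGroup X]
  [NormedSpace ℝ X] [MeasurableSpace X] [BorelSpace X] {f : Ω → X → EReal} {v : Ω → X →L[ℝ] ℝ}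
  {A : Set Ω} {W : Set X}

/-- A Carathéodory function: continuous in `x`, measurable in `ω`, on a second countable `W`. -/
lemma measurable_apply_prod (hv : IntegrallyWeakStarMeasurable μ v) (hA : A ∈ atomSigma μ)
    (hW : IsSeparable W) : Measurable (fun p : A × W => v (p.1 : Ω) (p.2 : X)) := by
  have := hW.separableSpace
  have : SecondCountableTopology W := UniformSpace.secondCountable_of_separable W
  have h := measurable_uncurry_of_continuous_of_measurable
    (u := fun (x : W) (ω : A) => v (ω : Ω) (x : X))
    (fun ω => (v ω).continuous.comp continuous_subtype_val) (fun x => hv A hA x)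
  exact h.comp measurable_swap

lemma aemeasurable_apply (hv : IntegrallyWeakStarMeasurable μ v) {u : Ω → X}
    (hu : IntegrallyStronglyMeasurable μ u) (hA : A ∈ atomSigma μ) :
    AEMeasurable (fun ω => v ω (u ω)) (μ.restrict A) :=
  aemeasurable_restrict_of_measurable_subtype (measurableSet_of_mem_atomSigma hA)
    (measurable_comp_of_prod (F := fun ω x => v ω x)
      (fun _ hW => measurable_apply_prod hv hA hW) (hu A hA))

-- Extension by `⊥` gives a function on all of `Ω × W`, as the selection theorem needs, without
-- creating new points above any level.
open Classical in
lemma measurable_conjugate_integrand (hf : IntegrallySeparablyMeasurable μ f)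
    (hv : IntegrallyWeakStarMeasurable μ v) (hA : A ∈ atomSigma μ) (hW : IsSeparable W) :
    Measurable (fun p : Ω × W =>
      if p.1 ∈ A then ((v p.1 p.2 : ℝ) : EReal) - f p.1 p.2 else ⊥) := by
  have hg : Measurable (fun p : A × W => ((v p.1 p.2 : ℝ) : EReal) - f p.1 p.2) :=
    (measurable_apply_prod hv hA hW).coe_real_ereal.sub (hf A hA W hW)
  have hs : MeasurableSet (Prod.fst ⁻¹' A : Set (Ω × W)) :=
    measurable_fst (measurableSet_of_mem_atomSigma hA)
  refine measurable_of_restrict_of_restrict_compl hs ?_ ?_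
  · have h1 : Measurable (fun p : (Prod.fst ⁻¹' A : Set (Ω × W)) =>
        ((⟨p.1.1, p.2⟩ : A), p.1.2)) :=
      (measurable_fst.comp measurable_subtype_coe).subtype_mk.prodMk
        (measurable_snd.comp measurable_subtype_coe)
    convert hg.comp h1 using 1
    ext p
    have : p.1.1 ∈ A := p.2
    simp [this]
  · convert measurable_const (a := (⊥ : EReal)) using 1
    ext p
    have : p.1.1 ∉ A := p.2
    simp [this]

lemma aemeasurable_conjugateOn [CompleteSpace X] (hf : IntegrallySeparablyMeasurable μ f)
    (hv : IntegrallyWeakStarMeasurable μ v) (hA : A ∈ atomSigma μ) {B : Set Ω} (hBA : B ⊆ A)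
    (hB : MeasurableSet B) [SigmaFinite (μ.restrict B)] (hWc : IsClosed W) (hW : IsSeparable W) :
    AEMeasurable (fun ω => conjugateOn (f ω) W (v ω)) (μ.restrict B) := by
  classical
  have := polishSpace_of_isClosed_of_isSeparable hWc hW
  have h1 := aemeasurable_iSup_of_polishSpace (μ.restrict B).toFinite
    (measurable_conjugate_integrand hf hv hA hW)
  refine (h1.mono_ac (absolutelyContinuous_toFinite _)).congr ?_
  filter_upwards [ae_restrict_mem hB] with ω hω
  simp only [hBA hω, if_true, conjugateOn]
  exact iSup_subtype (f := fun x : W => ((v ω x : ℝ) : EReal) - f ω x)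

/-- A strictly increasing bounded function on the extended reals. -/
def logistic (x : EReal) : ℝ≥0∞ := (1 + EReal.exp (-x))⁻¹

lemma logistic_strictMono : StrictMono logistic := by
  intro x y hxy
  refine ENNReal.inv_lt_inv.2 (ENNReal.add_lt_add_left ENNReal.one_ne_top ?_)
  exact EReal.exp_strictMono (EReal.neg_lt_neg_iff.2 hxy)

lemma logistic_le_one (x : EReal) : logistic x ≤ 1 :=
  ENNReal.inv_le_one.2 le_self_add

lemma measurable_logistic : Measurable logistic :=
  logistic_strictMono.monotone.measurable

/-- Maximize the integral of `logistic` of the supremum, for an equivalent finite measure, over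
closed separable sets; enlarging a maximizer cannot change the supremum on a set of positive
measure. -/
lemma exists_conjugateOn_max_of_sigmaFinite [CompleteSpace X]
    (hf : IntegrallySeparablyMeasurable μ f) (hv : IntegrallyWeakStarMeasurable μ v)
    (hA : A ∈ atomSigma μ) {B : Set Ω} (hBA : B ⊆ A) (hB : MeasurableSet B)
    [SigmaFinite (μ.restrict B)] :
    ∃ W : Set X, IsSeparable W ∧ ∀ W' : Set X, IsSeparable W' →
      ∀ᵐ ω ∂(μ.restrict B), conjugateOn (f ω) W' (v ω) ≤ conjugateOn (f ω) W (v ω) := by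
  set ν := (μ.restrict B).toFinite with hν
  have hm : ∀ W : Set X, IsClosed W → IsSeparable W →
      AEMeasurable (fun ω => logistic (conjugateOn (f ω) W (v ω))) ν := fun W hWc hW =>
    measurable_logistic.comp_aemeasurable
      ((aemeasurable_conjugateOn hf hv hA hBA hB hWc hW).mono_ac (toFinite_absolutelyContinuous _))
  let ι := {W : Set X // IsClosed W ∧ IsSeparable W}
  have : Nonempty ι := ⟨⟨∅, isClosed_empty, Set.countable_empty.isSeparable⟩⟩
  have hmono : ∀ {W W' : Set X}, W ⊆ W' → ∫⁻ ω, logistic (conjugateOn (f ω) W (v ω)) ∂ν ≤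
      ∫⁻ ω, logistic (conjugateOn (f ω) W' (v ω)) ∂ν := fun h =>
    lintegral_mono fun ω => logistic_strictMono.monotone (conjugateOn_mono _ h _)
  obtain ⟨⟨W, hWc, hW⟩, hmax⟩ := exists_forall_le_of_forall_seq
    (fun W : ι => ∫⁻ ω, logistic (conjugateOn (f ω) W (v ω)) ∂ν) (fun x =>
      ⟨⟨closure (⋃ n, x n), isClosed_closure,
        (IsSeparable.iUnion fun n => (x n).2.2).closure⟩, fun n =>
        hmono ((Set.subset_iUnion (fun n => (x n : Set X)) n).trans subset_closure)⟩)
  refine ⟨W, hW, fun W' hW' => ?_⟩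
  have hU : IsSeparable (closure (W ∪ W')) := (hW.union hW').closure
  have hfin : ∫⁻ ω, logistic (conjugateOn (f ω) W (v ω)) ∂ν ≠ ∞ := by
    refine ne_top_of_le_ne_top (measure_ne_top ν Set.univ) ?_
    calc _ ≤ ∫⁻ _, 1 ∂ν := lintegral_mono fun ω => logistic_le_one _
      _ = ν Set.univ := by simp
  have heq := ae_eq_of_ae_le_of_lintegral_le
    (ae_of_all ν fun ω => logistic_strictMono.monotone
      (conjugateOn_mono (f ω) (Set.subset_union_left.trans subset_closure) (v ω))) hfin
    (hm _ isClosed_closure hU) (hmax ⟨closure (W ∪ W'), isClosed_closure, hU⟩)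
  filter_upwards [absolutelyContinuous_toFinite (μ.restrict B) heq] with ω hω
  rw [logistic_strictMono.injective hω]
  exact conjugateOn_mono _ (Set.subset_union_right.trans subset_closure) _

end measurability

/-! ### Bounded selections of almost maximizers -/

/-- The strict inequality below `q` is what lets a point of `W` beat the value of `s`; it is gained
by shrinking a simple minorant by a factor below `1`. -/
lemma exists_simpleFunc_lt {Ω : Type*} [MeasurableSpace Ω] (ν : Measure Ω) [SigmaFinite ν]
    {q : Ω → ℝ≥0∞} {L : ℝ≥0∞} (hL : L < ∫⁻ ω, q ω ∂ν) :
    ∃ s : SimpleFunc Ω NNReal, (∀ ω, s ω ≠ 0 → (s ω : ℝ≥0∞) < q ω) ∧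
      ∫⁻ ω, (s ω : ℝ≥0∞) ∂ν ≠ ∞ ∧ L < ∫⁻ ω, (s ω : ℝ≥0∞) ∂ν := by
  rw [lintegral_eq_nnreal] at hL
  obtain ⟨r, hr⟩ := lt_iSup_iff.1 hL
  obtain ⟨hrq, hr⟩ := lt_iSup_iff.1 hr
  rw [← SimpleFunc.lintegral_eq_lintegral] at hr
  obtain ⟨s, hsr, hsf, hLs⟩ :=
    SimpleFunc.exists_lt_lintegral_simpleFunc_of_lt_lintegral (by simpa using hr)
  have hs0 : ∫⁻ ω, (s ω : ℝ≥0∞) ∂ν ≠ 0 := (bot_le.trans_lt hLs).ne'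
  have hdiv : L / ∫⁻ ω, (s ω : ℝ≥0∞) ∂ν < 1 := by
    rwa [ENNReal.div_lt_iff (Or.inl hs0) (Or.inl hsf.ne), one_mul]
  -- The factor lies strictly between `L / ∫ s` and `1`, so the scaled integral still exceeds `L`.
  obtain ⟨t, hLt, ht⟩ := ENNReal.lt_iff_exists_nnreal_btwn.1 hdiv
  have ht1 : t < 1 := by exact_mod_cast ht
  rw [ENNReal.div_lt_iff (Or.inl hs0) (Or.inl hsf.ne)] at hLt
  have hint : ∫⁻ ω, ((s.map (fun x => t * x) ω : NNReal) : ℝ≥0∞) ∂ν =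
      t * ∫⁻ ω, (s ω : ℝ≥0∞) ∂ν := by
    rw [← lintegral_const_mul _ s.measurable.coe_nnreal_ennreal]
    simp
  refine ⟨s.map (fun x => t * x), fun ω hω => ?_, ?_, ?_⟩
  · have hne : s ω ≠ 0 := by
      intro h0
      simp [h0] at hω
    have h1 : t * s ω < s ω := mul_lt_of_lt_one_left (pos_iff_ne_zero.2 hne) ht1
    calc ((s.map (fun x => t * x) ω : NNReal) : ℝ≥0∞) < s ω := by
          simpa using (ENNReal.coe_lt_coe.2 h1)
      _ ≤ r ω := ENNReal.coe_le_coe.2 (hsr ω)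
      _ ≤ q ω := hrq ω
  · rw [hint]
    exact ENNReal.mul_ne_top ENNReal.coe_ne_top hsf.ne
  · rw [hint]; exact hLt

section selection

variable {Ω X : Type*} [MeasurableSpace Ω] {μ : Measure Ω} [NormedAddCommGroup X]
  [NormedSpace ℝ X] [CompleteSpace X] [MeasurableSpace X] [BorelSpace X] {f : Ω → X → EReal}
  {v : Ω → X →L[ℝ] ℝ} {A B : Set Ω} {W : Set X}

/-- Aumann's theorem, applied to the set of pairs at which the value exceeds `g`; its sections are
nonempty where the supremum does. -/
lemma exists_measurable_almost_maximizer (hf : IntegrallySeparablyMeasurable μ f)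
    (hv : IntegrallyWeakStarMeasurable μ v) (hA : A ∈ atomSigma μ) (hBA : B ⊆ A)
    (hB : MeasurableSet B) [SigmaFinite (μ.restrict B)] (hWc : IsClosed W) (hW : IsSeparable W)
    (hWn : W.Nonempty) {g : Ω → ℝ} (hg : Measurable g) :
    ∃ u : Ω → X, StronglyMeasurable u ∧ ∀ᵐ ω ∂(μ.restrict B),
      (g ω : EReal) < conjugateOn (f ω) W (v ω) →
        (g ω : EReal) ≤ ((v ω (u ω) : ℝ) : EReal) - f ω (u ω) := by
  classical
  have := polishSpace_of_isClosed_of_isSeparable hWc hW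
  have := hWn.to_subtype
  have hG : MeasurableSet {p : Ω × W | (g p.1 : EReal) <
      if p.1 ∈ A then ((v p.1 p.2 : ℝ) : EReal) - f p.1 p.2 else ⊥} :=
    measurableSet_lt (hg.comp measurable_fst).coe_real_ereal
      (measurable_conjugate_integrand hf hv hA hW)
  obtain ⟨s, hs, hsG⟩ := exists_measurable_selection (μ.restrict B).toFinite hG
  refine ⟨fun ω => s ω, continuous_subtype_val.comp_stronglyMeasurable hs.stronglyMeasurable, ?_⟩
  filter_upwards [absolutelyContinuous_toFinite (μ.restrict B) hsG, ae_restrict_mem hB]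
    with ω hω hωB hlt
  have hωA := hBA hωB
  simp only [hωA, if_true] at hω
  obtain ⟨x, hx⟩ := lt_iSup_iff.1 hlt
  obtain ⟨hxW, hx⟩ := lt_iSup_iff.1 hx
  exact (hω ⟨⟨x, hxW⟩, hx⟩).le

lemma exists_bounded_almost_maximizer (hf : IntegrallySeparablyMeasurable μ f)
    (hv : IntegrallyWeakStarMeasurable μ v) (hA : A ∈ atomSigma μ) (hBA : B ⊆ A)
    (hB : MeasurableSet B) [SigmaFinite (μ.restrict B)] (hWc : IsClosed W) (hW : IsSeparable W)
    (hWn : W.Nonempty) {g : Ω → ℝ} (hg : Measurable g) {L : ℝ≥0∞}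
    (hL : L < ∫⁻ ω in B, (conjugateOn (f ω) W (v ω) - (g ω : EReal)).toENNReal ∂μ) :
    ∃ (F : Set Ω) (u : Ω → X) (s : Ω → NNReal), F ⊆ B ∧ MeasurableSet F ∧ μ F < ∞ ∧
      StronglyMeasurable u ∧ (∃ C : ℝ, ∀ ω, ‖u ω‖ ≤ C) ∧ Measurable s ∧
      ∫⁻ ω in F, s ω ∂μ ≠ ∞ ∧ L < ∫⁻ ω in F, s ω ∂μ ∧
      ∀ᵐ ω ∂(μ.restrict F), ((g ω + s ω : ℝ) : EReal) ≤ ((v ω (u ω) : ℝ) : EReal) - f ω (u ω) := by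
  obtain ⟨s, hsq, hsf, hLs⟩ := exists_simpleFunc_lt _ hL
  obtain ⟨u, hu, hug⟩ := exists_measurable_almost_maximizer hf hv hA hBA hB hWc hW hWn
    (g := fun ω => g ω + s ω) (hg.add s.measurable.coe_nnreal_real)
  -- Cutting off makes the measure finite and `u` bounded by `n`. These sets increase to the part of
  -- `B` where `s ≠ 0`, so monotone convergence keeps the integral above `L`.
  let F : ℕ → Set Ω := fun n =>
    (spanningSets (μ.restrict B) n ∩ {ω | s ω ≠ 0} ∩ {ω | ‖u ω‖ ≤ n}) ∩ B
  have hFm : ∀ n, MeasurableSet (F n) := fun n =>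
    (((measurableSet_spanningSets _ n).inter (s.measurable (measurableSet_singleton 0).compl)).inter
      (measurableSet_le hu.norm.measurable measurable_const)).inter hB
  have hFB : ∀ n, F n ⊆ B := fun n => Set.inter_subset_right
  have hFmono : Monotone F := by
    rintro m n hmn ω ⟨⟨⟨h1, h2⟩, h3⟩, h4⟩
    exact ⟨⟨⟨spanningSets_mono hmn h1, h2⟩, le_trans (b := (m : ℝ)) h3 (Nat.cast_le.2 hmn)⟩, h4⟩
  have hFU : ⋃ n, F n = {ω | s ω ≠ 0} ∩ B := by
    refine Set.Subset.antisymm (Set.iUnion_subset fun n ω hω => ⟨hω.1.1.2, hω.2⟩) ?_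
    rintro ω ⟨h1, h2⟩
    obtain ⟨n, hn⟩ := exists_nat_ge ‖u ω‖
    obtain ⟨k, hk⟩ := Set.mem_iUnion.1
      ((iUnion_spanningSets (μ.restrict B)).symm ▸ Set.mem_univ ω)
    refine Set.mem_iUnion.2 ⟨max n k, ⟨⟨spanningSets_mono (le_max_right _ _) hk, h1⟩, ?_⟩, h2⟩
    exact hn.trans (by exact_mod_cast le_max_left n k)
  have hint : ∫⁻ ω in B, (s ω : ℝ≥0∞) ∂μ = ⨆ n, ∫⁻ ω in F n, (s ω : ℝ≥0∞) ∂μ := by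
    have hsm : MeasurableSet {ω | s ω ≠ 0} := s.measurable (measurableSet_singleton 0).compl
    rw [← setLIntegral_iUnion_of_directed _ hFmono.directed_le, hFU,
      ← Measure.restrict_restrict hsm]
    refine (setLIntegral_eq_of_support_subset fun ω hω => ?_).symm
    simpa using hω
  rw [hint] at hLs
  obtain ⟨n, hn⟩ := lt_iSup_iff.1 hLs
  refine ⟨F n, (F n).indicator u, s, hFB n, hFm n, ?_, hu.indicator (hFm n), ⟨n, fun ω => ?_⟩,
    s.measurable, ne_top_of_le_ne_top hsf (lintegral_mono_set (hFB n)), hn, ?_⟩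
  · refine lt_of_le_of_lt ?_ (measure_spanningSets_lt_top (μ.restrict B) n)
    rw [Measure.restrict_apply (measurableSet_spanningSets _ n)]
    exact measure_mono fun ω hω => ⟨hω.1.1.1, hω.2⟩
  · by_cases hω : ω ∈ F n
    · rw [Set.indicator_of_mem hω]; exact hω.1.2
    · rw [Set.indicator_of_notMem hω]; simp
  · filter_upwards [ae_restrict_of_ae_restrict_of_subset (hFB n) hug, ae_restrict_mem (hFm n)]
      with ω hω hωF
    rw [Set.indicator_of_mem hωF]
    refine hω ?_
    have h1 := hsq ω hωF.1.1.2
    have h2 : ((s ω : ℝ≥0∞) : EReal) < conjugateOn (f ω) W (v ω) - (g ω : EReal) := by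
      have h3 : 0 < (conjugateOn (f ω) W (v ω) - (g ω : EReal)).toENNReal := bot_le.trans_lt h1
      rw [← EReal.coe_toENNReal (EReal.toENNReal_pos_iff.1 h3).le]
      exact EReal.coe_ennreal_lt_coe_ennreal_iff.2 h1
    have h3 := EReal.add_lt_of_lt_sub h2
    rw [add_comm]
    exact h3

end selection

/-! ### The conjugate functional -/

section conjugate

variable {Ω X : Type*} [MeasurableSpace Ω] [NormedAddCommGroup X] [NormedSpace ℝ X]
  [MeasurableSpace X]

/-- The standing assumptions on the space `R`, the integrand `f` and the function `v`. -/
structure Admissible (μ : Measure Ω) (R : Submodule ℝ (Ω → X)) (f : Ω → X → EReal)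
    (v : Ω → X →L[ℝ] ℝ) : Prop where
  stronglyMeasurable : ∀ u ∈ R, IntegrallyStronglyMeasurable μ u
  almostDecomposable : AlmostDecomposable μ (R : Set (Ω → X))
  weakStarMeasurable : IntegrallyWeakStarMeasurable μ v
  pairing_ne_top : ∀ u ∈ R, pairing μ u v ≠ ⊤
  pairing_ne_bot : ∀ u ∈ R, pairing μ u v ≠ ⊥
  separablyMeasurable : IntegrallySeparablyMeasurable μ f
  exists_ne_top : ∃ u ∈ R, integralFunctional μ f u ≠ ⊤
  conjugateOn_nonpos : ∀ A : Set Ω, IsMeasureAtom μ A → μ A = ∞ → ∀ W : Set X, IsSeparable W →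
    ∀ᵐ ω ∂(μ.restrict A), conjugateOn (f ω) W (v ω) ≤ 0

variable {μ : Measure Ω} {R : Submodule ℝ (Ω → X)} {f : Ω → X → EReal} {v : Ω → X →L[ℝ] ℝ}
  {u : Ω → X} {A D : Set Ω}

namespace Admissible

/-- A set with only the measures `0` and `∞` inside it is null or itself an infinite atom. -/
lemma ae_conjugateOn_nonpos (h : Admissible μ R f v) (hD : MeasurableSet D)
    (hDμ : ∀ E, MeasurableSet E → E ⊆ D → μ E = 0 ∨ μ E = ∞) {W : Set X} (hW : IsSeparable W) :
    ∀ᵐ ω ∂(μ.restrict D), conjugateOn (f ω) W (v ω) ≤ 0 := by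
  rcases hDμ D hD subset_rfl with h0 | h0
  · rw [Measure.restrict_eq_zero.2 h0]; simp
  · refine h.conjugateOn_nonpos D ⟨hD, by simp [h0], fun E hE hED => ?_⟩ h0 W hW
    rw [h0]; exact hDμ E hE hED

variable [BorelSpace X]

lemma integrable_apply (h : Admissible μ R f v) (hu : u ∈ R) (hA : A ∈ atomSigma μ) :
    Integrable (fun ω => v ω (u ω)) (μ.restrict A) := by
  have hm := aemeasurable_apply h.weakStarMeasurable (h.stronglyMeasurable u hu) hA
  have hc := isConsistent_const (μ := μ) (fun ω => ((v ω (u ω) : ℝ) : EReal))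
  obtain ⟨p, hp, hpe⟩ := exists_integrable_of_extIntegral_finite hm.coe_real_ereal
    (extIntegral_restrict_ne_top hc (h.pairing_ne_top u hu) hA)
    (extIntegral_restrict_ne_bot hc (h.pairing_ne_top u hu) (h.pairing_ne_bot u hu) hA)
  refine hp.congr (hpe.mono fun ω hω => ?_)
  exact (EReal.coe_eq_coe_iff.1 hω).symm

/-- On `D` finite integrals force vanishing: `⟨v,u⟩ = 0` and `f(u)⁺ = 0` a.e. -/
lemma ae_nonneg_apply_sub (h : Admissible μ R f v) (hu : u ∈ R)
    (hI : integralFunctional μ f u ≠ ⊤) (hA : A ∈ atomSigma μ) (hDA : D ⊆ A)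
    (hD : MeasurableSet D) (hDμ : ∀ E, MeasurableSet E → E ⊆ D → μ E = 0 ∨ μ E = ∞) :
    ∀ᵐ ω ∂(μ.restrict D), 0 ≤ ((v ω (u ω) : ℝ) : EReal) - f ω (u ω) := by
  have hp := (h.integrable_apply hu hA).mono_measure (Measure.restrict_mono hDA le_rfl)
  have h1 := ae_eq_zero_of_lintegral_ne_top hD hDμ hp.1.aemeasurable.enorm hp.2.ne
  have hfm := aemeasurable_integrand h.separablyMeasurable (h.stronglyMeasurable u hu) hA
  have hft := extIntegral_restrict_ne_top (isConsistent_const (μ := μ) fun ω => f ω (u ω)) hI hA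
  rw [Ne, extIntegral_eq_top_iff] at hft
  have h2 := ae_eq_zero_of_lintegral_ne_top hD hDμ (hfm.mono_set hDA).ereal_toENNReal
    (ne_top_of_le_ne_top hft (lintegral_mono_set hDA))
  filter_upwards [h1, h2] with ω h1 h2
  rw [enorm_eq_zero] at h1
  rw [EReal.toENNReal_eq_zero_iff] at h2
  rw [h1, EReal.coe_zero, EReal.sub_nonneg (by simp) (by simp)]
  exact h2

/-- On a set of `atomSigma μ` one closed separable set realizes the essential supremum. -/
lemma exists_conjugateOn_max [CompleteSpace X] (h : Admissible μ R f v) (hA : A ∈ atomSigma μ) :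
    ∃ W : Set X, IsClosed W ∧ IsSeparable W ∧ W.Nonempty ∧
      AEMeasurable (fun ω => conjugateOn (f ω) W (v ω)) (μ.restrict A) ∧
      ∀ W' : Set X, IsSeparable W' →
        ∀ᵐ ω ∂(μ.restrict A), conjugateOn (f ω) W' (v ω) ≤ conjugateOn (f ω) W (v ω) := by
  obtain ⟨u, hu, hI⟩ := h.exists_ne_top
  obtain ⟨D, B, hD, hB, -, hAe, hBs, hDμ⟩ := exists_decomposition_of_mem_atomSigma hA
  have hDA : D ⊆ A := hAe ▸ Set.subset_union_left
  have hBA : B ⊆ A := hAe ▸ Set.subset_union_right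
  obtain ⟨W₀, hW₀, hmax⟩ := exists_conjugateOn_max_of_sigmaFinite h.separablyMeasurable
    h.weakStarMeasurable hA hBA hB
  have huA : IsSeparable (u '' A) := by
    have := (h.stronglyMeasurable u hu A hA).isSeparable_range
    rwa [← Set.image_eq_range] at this
  -- `W₀` is maximal on the σ-finite part, `u '' A` raises the supremum to `0` on `D`, and `0`
  -- ensures nonemptiness.
  set W := closure (W₀ ∪ (u '' A ∪ {0})) with hWdef
  have hW : IsSeparable W :=
    (hW₀.union (huA.union (Set.countable_singleton 0).isSeparable)).closure
  have hDzero : ∀ᵐ ω ∂(μ.restrict D), conjugateOn (f ω) W (v ω) = 0 := by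
    filter_upwards [h.ae_conjugateOn_nonpos hD hDμ hW, h.ae_nonneg_apply_sub hu hI hA hDA hD hDμ,
      ae_restrict_mem hD] with ω h1 h2 h3
    refine le_antisymm h1 (h2.trans (le_conjugateOn _ ?_ _))
    exact subset_closure (Or.inr (Or.inl ⟨ω, hDA h3, rfl⟩))
  refine ⟨W, isClosed_closure, hW, ⟨0, subset_closure (Or.inr (Or.inr rfl))⟩, ?_,
    fun W' hW' => ?_⟩
  · rw [hAe, aemeasurable_union_iff]
    exact ⟨aemeasurable_const.congr (Filter.EventuallyEq.symm hDzero),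
      aemeasurable_conjugateOn h.separablyMeasurable h.weakStarMeasurable hA hBA hB
        isClosed_closure hW⟩
  · rw [hAe, ae_restrict_union_iff]
    constructor
    · filter_upwards [h.ae_conjugateOn_nonpos hD hDμ hW', hDzero] with ω h1 h2
      rw [h2]; exact h1
    · filter_upwards [hmax W' hW'] with ω hω
      exact hω.trans (conjugateOn_mono _ (Set.subset_union_left.trans subset_closure) _)

end Admissible

end conjugate

/-! ### Comparison of exhausting integrals -/

section comparison

variable {Ω : Type*} [MeasurableSpace Ω] {μ : Measure Ω} {α β : Set Ω → Ω → EReal}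

/-- The union of two carriers carries both families, which reduces the claim to one extended
Lebesgue integral. -/
lemma exhIntegralFam_mono (hα : IsConsistent μ α) (hβ : IsConsistent μ β)
    (hle : ∀ A ∈ atomSigma μ, α A ≤ᵐ[μ.restrict A] β A) :
    exhIntegralFam μ α ≤ exhIntegralFam μ β := by
  obtain ⟨A, hA⟩ := hα.exists_isCarrier
  obtain ⟨B, hB⟩ := hβ.exists_isCarrier
  have hAB := union_mem_atomSigma hA.1 hB.1
  rw [(hA.mono hAB Set.subset_union_left).exhIntegralFam_eq,
    (hB.mono hAB Set.subset_union_right).exhIntegralFam_eq]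
  exact extIntegral_mono (hle _ hAB)

lemma exhIntegralFam_congr (hα : IsConsistent μ α) (hβ : IsConsistent μ β)
    (heq : ∀ A ∈ atomSigma μ, α A =ᵐ[μ.restrict A] β A) :
    exhIntegralFam μ α = exhIntegralFam μ β :=
  le_antisymm (exhIntegralFam_mono hα hβ fun A hA => (heq A hA).le)
    (exhIntegralFam_mono hβ hα fun A hA => (heq A hA).symm.le)

lemma ae_eq_of_exhIntegralFam_eq (hα : IsConsistent μ α) (hβ : IsConsistent μ β)
    (hαm : ∀ A ∈ atomSigma μ, AEMeasurable (α A) (μ.restrict A))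
    (hβm : ∀ A ∈ atomSigma μ, AEMeasurable (β A) (μ.restrict A))
    (hle : ∀ A ∈ atomSigma μ, α A ≤ᵐ[μ.restrict A] β A)
    (heq : exhIntegralFam μ α = exhIntegralFam μ β) (ht : exhIntegralFam μ α ≠ ⊤)
    (hb : exhIntegralFam μ α ≠ ⊥) {C : Set Ω} (hC : C ∈ atomSigma μ) :
    α C =ᵐ[μ.restrict C] β C := by
  obtain ⟨A, hA⟩ := hα.exists_isCarrier
  obtain ⟨B, hB⟩ := hβ.exists_isCarrier
  have hU := union_mem_atomSigma (union_mem_atomSigma hA.1 hB.1) hC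
  have hA' := hA.mono hU (Set.subset_union_left.trans Set.subset_union_left)
  have hB' := hB.mono hU (Set.subset_union_right.trans Set.subset_union_left)
  have hCU : C ⊆ A ∪ B ∪ C := Set.subset_union_right
  rw [hA'.exhIntegralFam_eq] at ht hb heq
  rw [hB'.exhIntegralFam_eq] at heq
  have h1 := ae_restrict_of_ae_restrict_of_subset hCU
    (ae_eq_of_extIntegral_eq (hαm _ hU) (hβm _ hU) (hle _ hU) heq ht hb)
  filter_upwards [hα C hC _ hU hCU, h1, hβ C hC _ hU hCU] with ω h1 h2 h3
  rw [h1, h2, h3]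

end comparison

/-! ### The conjugate as the integral of the essential supremum -/

section conjugate

variable {Ω X : Type*} [MeasurableSpace Ω] [NormedAddCommGroup X] [NormedSpace ℝ X]
  {μ : Measure Ω} {R : Submodule ℝ (Ω → X)} {f : Ω → X → EReal} {v : Ω → X →L[ℝ] ℝ} {u : Ω → X}
  {A : Set Ω}

lemma le_conjugateFunctional (hu : u ∈ R) :
    pairing μ u v - integralFunctional μ f u ≤ conjugateFunctional μ f R v :=
  le_iSup₂ (f := fun u (_ : u ∈ R) => pairing μ u v - integralFunctional μ f u) u hu

lemma ae_eq_of_isEssSupOn {m : Ω → EReal} (hm : IsEssSupOn μ A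
      (fun (W : {W : Set X // IsSeparable W}) ω => conjugateOn (f ω) (W : Set X) (v ω)) m)
    {W : Set X} (hW : IsSeparable W)
    (hWm : AEMeasurable (fun ω => conjugateOn (f ω) W (v ω)) (μ.restrict A))
    (hmax : ∀ W' : Set X, IsSeparable W' →
      ∀ᵐ ω ∂(μ.restrict A), conjugateOn (f ω) W' (v ω) ≤ conjugateOn (f ω) W (v ω)) :
    m =ᵐ[μ.restrict A] fun ω => conjugateOn (f ω) W (v ω) := by
  filter_upwards [hm.2.1 ⟨W, hW⟩, hm.2.2 _ hWm fun W' => hmax W' W'.2] with ω h1 h2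
  exact le_antisymm h2 h1

end conjugate

section conjugate

variable {Ω X : Type*} [MeasurableSpace Ω] [NormedAddCommGroup X] [NormedSpace ℝ X]
  [MeasurableSpace X] {μ : Measure Ω} {R : Submodule ℝ (Ω → X)} {f : Ω → X → EReal}
  {v : Ω → X →L[ℝ] ℝ} {u : Ω → X} {A B : Set Ω} {m : Set Ω → Ω → EReal}

namespace Admissible

lemma conjugateFunctional_ne_bot (h : Admissible μ R f v) : conjugateFunctional μ f R v ≠ ⊥ := by
  obtain ⟨u, hu, hI⟩ := h.exists_ne_top
  refine fun hb => absurd (le_conjugateFunctional (f := f) (μ := μ) (v := v) hu) ?_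
  rw [hb, not_le]
  lift pairing μ u v to ℝ using ⟨h.pairing_ne_top u hu, h.pairing_ne_bot u hu⟩ with p
  induction hx : integralFunctional μ f u with
  | bot => simp
  | coe x => rw [← EReal.coe_sub]; exact EReal.bot_lt_coe _
  | top => exact absurd hx hI

lemma pairing_sub_integralFunctional_finite (h : Admissible μ R f v) (hu : u ∈ R)
    (hI : integralFunctional μ f u ≠ ⊤) (hI' : integralFunctional μ f u ≠ ⊥) :
    pairing μ u v - integralFunctional μ f u ≠ ⊤ ∧
      pairing μ u v - integralFunctional μ f u ≠ ⊥ := by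
  have h1 := h.pairing_ne_top u hu
  have h2 := h.pairing_ne_bot u hu
  lift integralFunctional μ f u to ℝ using ⟨hI, hI'⟩ with r
  lift pairing μ u v to ℝ using ⟨h1, h2⟩ with p
  rw [← EReal.coe_sub]
  exact ⟨EReal.coe_ne_top _, EReal.coe_ne_bot _⟩

lemma ae_apply_sub_le (h : Admissible μ R f v) (hm : ∀ A ∈ atomSigma μ, IsEssSupOn μ A
      (fun (W : {W : Set X // IsSeparable W}) ω => conjugateOn (f ω) (W : Set X) (v ω)) (m A))
    (hu : u ∈ R) (hA : A ∈ atomSigma μ) :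
    ∀ᵐ ω ∂(μ.restrict A), ((v ω (u ω) : ℝ) : EReal) - f ω (u ω) ≤ m A ω := by
  have huA : IsSeparable (u '' A) := by
    have := (h.stronglyMeasurable u hu A hA).isSeparable_range
    rwa [← Set.image_eq_range] at this
  filter_upwards [(hm A hA).2.1 ⟨u '' A, huA⟩, ae_restrict_mem (measurableSet_of_mem_atomSigma hA)]
    with ω h1 h2
  exact (le_conjugateOn _ (Set.mem_image_of_mem u h2) _).trans h1

variable [BorelSpace X]

lemma aemeasurable_apply_sub (h : Admissible μ R f v) (hu : u ∈ R) (hA : A ∈ atomSigma μ) :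
    AEMeasurable (fun ω => ((v ω (u ω) : ℝ) : EReal) - f ω (u ω)) (μ.restrict A) :=
  (aemeasurable_apply h.weakStarMeasurable (h.stronglyMeasurable u hu) hA).coe_real_ereal.sub
    (aemeasurable_integrand h.separablyMeasurable (h.stronglyMeasurable u hu) hA)

lemma pairing_eq (h : Admissible μ R f v) (hu : u ∈ R)
    (hA : IsCarrier μ (fun _ ω => ((v ω (u ω) : ℝ) : EReal)) A) :
    pairing μ u v = ((∫ ω in A, v ω (u ω) ∂μ : ℝ) : EReal) := by
  rw [pairing, hA.exhIntegral_eq, extIntegral_coe (h.integrable_apply hu hA.1)]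

lemma pairing_sub_eq_extIntegral (h : Admissible μ R f v) (hu : u ∈ R)
    (hI : integralFunctional μ f u ≠ ⊤)
    (hA : IsCarrier μ (fun _ ω => ((v ω (u ω) : ℝ) : EReal)) A)
    (hA' : IsCarrier μ (fun _ ω => f ω (u ω)) A) :
    pairing μ u v - integralFunctional μ f u =
      extIntegral (μ.restrict A) (fun ω => ((v ω (u ω) : ℝ) : EReal) - f ω (u ω)) := by
  rw [integralFunctional, hA'.exhIntegral_eq] at hI ⊢
  rw [h.pairing_eq hu hA, extIntegral_coe_sub (h.integrable_apply hu hA.1)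
    (aemeasurable_integrand h.separablyMeasurable (h.stronglyMeasurable u hu) hA.1) hI]

lemma pairing_sub_eq_exhIntegral (h : Admissible μ R f v) (hu : u ∈ R)
    (hI : integralFunctional μ f u ≠ ⊤) :
    pairing μ u v - integralFunctional μ f u =
      exhIntegral μ (fun ω => ((v ω (u ω) : ℝ) : EReal) - f ω (u ω)) := by
  obtain ⟨A, hA⟩ := (isConsistent_const (μ := μ) fun ω =>
    ((v ω (u ω) : ℝ) : EReal)).exists_isCarrier
  obtain ⟨B, hB⟩ := (isConsistent_const (μ := μ) fun ω => f ω (u ω)).exists_isCarrier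
  obtain ⟨C, hC⟩ := (isConsistent_const (μ := μ) fun ω =>
    ((v ω (u ω) : ℝ) : EReal) - f ω (u ω)).exists_isCarrier
  have hAB := union_mem_atomSigma hA.1 hB.1
  have hU := union_mem_atomSigma hAB hC.1
  rw [(hC.mono hU Set.subset_union_right).exhIntegral_eq]
  exact h.pairing_sub_eq_extIntegral hu hI
    (hA.mono hU (Set.subset_union_left.trans Set.subset_union_left))
    (hB.mono hU (Set.subset_union_right.trans Set.subset_union_left))

/-- Replacing `u` by an almost maximizer on a suitable set of finite measure. -/
lemma exists_add_le_pairing_sub [CompleteSpace X] (h : Admissible μ R f v) (hu : u ∈ R)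
    (hI : integralFunctional μ f u ≠ ⊤) (hI' : integralFunctional μ f u ≠ ⊥)
    (hAv : IsCarrier μ (fun _ ω => ((v ω (u ω) : ℝ) : EReal)) A)
    (hAf : IsCarrier μ (fun _ ω => f ω (u ω)) A) (hBA : B ⊆ A) (hB : MeasurableSet B)
    [SigmaFinite (μ.restrict B)] {W : Set X} (hWc : IsClosed W) (hW : IsSeparable W)
    (hWn : W.Nonempty) {g : Ω → ℝ} (hg : Measurable g) (hgi : Integrable g (μ.restrict A))
    (hgu : ∀ᵐ ω ∂(μ.restrict A), ((v ω (u ω) : ℝ) : EReal) - f ω (u ω) = (g ω : EReal)) {L : ℝ≥0∞}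
    (hL : L < ∫⁻ ω in B, (conjugateOn (f ω) W (v ω) - (g ω : EReal)).toENNReal ∂μ) :
    ∃ w ∈ R, ((∫ ω in A, g ω ∂μ : ℝ) : EReal) + (L : EReal) ≤
      pairing μ w v - integralFunctional μ f w := by
  classical
  obtain ⟨F, u₁, s, hFB, hF, hFμ, hu₁, hu₁b, hs, hsf, hLs, hsu⟩ :=
    exists_bounded_almost_maximizer h.separablyMeasurable h.weakStarMeasurable hAv.1 hBA hB hWc hW
      hWn hg hL
  -- The slack `∫_F s - L` is the loss allowed on `F \ E`, so the integral of `s` over `E` remains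
  -- at least `L`.
  obtain ⟨δ, hδ, hδs⟩ := exists_pos_setLIntegral_lt_of_measure_lt hsf (tsub_pos_of_lt hLs).ne'
  obtain ⟨E, hEF, hE, hEμ, hwR⟩ := h.almostDecomposable u hu F hF hFμ δ hδ u₁ hu₁ hu₁b
  have hEA : E ⊆ A := hEF.trans (hFB.trans hBA)
  have hAm := measurableSet_of_mem_atomSigma hAv.1
  have hsE : ∫⁻ ω in E, (s ω : ℝ≥0∞) ∂μ ≠ ∞ :=
    ne_top_of_le_ne_top hsf (lintegral_mono_set hEF)
  have hLE : L ≤ ∫⁻ ω in E, (s ω : ℝ≥0∞) ∂μ := by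
    have h1 := hδs (F \ E) ((Measure.restrict_apply_le _ _).trans_lt hEμ)
    rw [Measure.restrict_restrict (hF.diff hE), Set.inter_eq_self_of_subset_left
      Set.sdiff_subset] at h1
    have h2 := lintegral_inter_add_sdiff (fun ω => (s ω : ℝ≥0∞)) F hE (μ := μ)
    rw [Set.inter_eq_self_of_subset_right hEF] at h2
    by_contra! h3
    have h4 : ∫⁻ ω in F, (s ω : ℝ≥0∞) ∂μ < L + (∫⁻ ω in F, (s ω : ℝ≥0∞) ∂μ - L) := by
      conv_lhs => rw [← h2]
      exact ENNReal.add_lt_add h3 h1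
    rw [add_tsub_cancel_of_le hLs.le] at h4
    exact lt_irrefl _ h4
  set w : Ω → X := E.piecewise u₁ u with hw
  obtain ⟨C₁, hC₁⟩ := (isConsistent_const (μ := μ) fun ω =>
    ((v ω (w ω) : ℝ) : EReal)).exists_isCarrier
  obtain ⟨C₂, hC₂⟩ := (isConsistent_const (μ := μ) fun ω => f ω (w ω)).exists_isCarrier
  -- The modified function `w` may need a larger carrier; on `C \ A` it equals `u`, whose integrands
  -- vanish there.
  set C := A ∪ (C₁ ∪ C₂) with hC
  have hCs : C ∈ atomSigma μ := union_mem_atomSigma hAv.1 (union_mem_atomSigma hC₁.1 hC₂.1)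
  have hAC : A ⊆ C := Set.subset_union_left
  have hCv := hC₁.mono hCs (Set.subset_union_left.trans Set.subset_union_right)
  have hCf := hC₂.mono hCs (Set.subset_union_right.trans Set.subset_union_right)
  have hCm := measurableSet_of_mem_atomSigma hCs
  have hus := h.stronglyMeasurable u hu
  have hws := h.stronglyMeasurable w hwR
  have hv0 := hAv.ae_eq_zero (isConsistent_const _) (h.pairing_ne_top u hu) (h.pairing_ne_bot u hu)
    hCs hAC (aemeasurable_apply h.weakStarMeasurable hus hCs).coe_real_ereal
  have hf0 := hAf.ae_eq_zero (isConsistent_const _) hI hI' hCs hAC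
    (aemeasurable_integrand h.separablyMeasurable hus hCs)
  have hsi : Integrable (fun ω => (s ω : ℝ)) (μ.restrict E) :=
    integrable_toReal_of_lintegral_ne_top hs.coe_nnreal_ennreal.aemeasurable hsE
  have hgC : Integrable (A.indicator g) (μ.restrict C) := by
    rw [integrable_indicator_iff hAm, IntegrableOn, Measure.restrict_restrict hAm,
      Set.inter_eq_self_of_subset_left hAC]
    exact hgi
  have hsC : Integrable (E.indicator fun ω => (s ω : ℝ)) (μ.restrict C) := by
    rw [integrable_indicator_iff hE, IntegrableOn, Measure.restrict_restrict hE,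
      Set.inter_eq_self_of_subset_left (hEA.trans hAC)]
    exact hsi
  -- An integrable minorant of `⟨v,w⟩ - f(w)` on `C`: the old value `g`, plus the gain `s` on `E`.
  -- It also yields `f(w) ≤ ⟨v,w⟩ - k`, hence `I_f(w) < ∞`.
  let k : Ω → ℝ := fun ω => A.indicator g ω + E.indicator (fun ω => (s ω : ℝ)) ω
  have hki : Integrable k (μ.restrict C) := hgC.add hsC
  have hkint : ∫ ω in C, k ω ∂μ = ∫ ω in A, g ω ∂μ + ∫ ω in E, (s ω : ℝ) ∂μ := by
    rw [integral_add hgC hsC, integral_indicator hAm, integral_indicator hE,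
      Measure.restrict_restrict hAm, Measure.restrict_restrict hE,
      Set.inter_eq_self_of_subset_left hAC, Set.inter_eq_self_of_subset_left (hEA.trans hAC)]
  have hk : ∀ᵐ ω ∂(μ.restrict C), (k ω : EReal) ≤ ((v ω (w ω) : ℝ) : EReal) - f ω (w ω) := by
    rw [ae_restrict_iff' hAm] at hgu
    rw [ae_restrict_iff' hF] at hsu
    filter_upwards [ae_restrict_of_ae hgu, ae_restrict_of_ae hsu, hv0, hf0] with ω h1 h2 h3 h4
    by_cases hωE : ω ∈ E
    · have hωA := hEA hωE
      simp only [k, hw, Set.piecewise_eq_of_mem _ _ _ hωE, Set.indicator_of_mem hωA,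
        Set.indicator_of_mem hωE]
      exact h2 (hEF hωE)
    · simp only [k, hw, Set.piecewise_eq_of_notMem _ _ _ hωE, Set.indicator_of_notMem hωE,
        add_zero]
      by_cases hωA : ω ∈ A
      · rw [h1 hωA, Set.indicator_of_mem hωA]
      · rw [h3 hωA, h4 hωA, Set.indicator_of_notMem hωA]; simp
  have hIw : integralFunctional μ f w ≠ ⊤ := by
    have hvw := h.integrable_apply hwR hCs
    rw [integralFunctional, hCf.exhIntegral_eq]
    refine ne_top_of_le_ne_top (b := extIntegral (μ.restrict C)
      (fun ω => ((v ω (w ω) - k ω : ℝ) : EReal))) ?_ (extIntegral_mono ?_)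
    · rw [extIntegral_coe (p := fun ω => v ω (w ω) - k ω) (hvw.sub hki)]
      exact EReal.coe_ne_top _
    · filter_upwards [hk] with ω hω
      induction hx : f ω (w ω) with
      | bot => exact bot_le
      | top => rw [hx] at hω; simp at hω
      | coe x => rw [hx] at hω; norm_cast at hω ⊢; linarith
  refine ⟨w, hwR, ?_⟩
  rw [h.pairing_sub_eq_extIntegral hwR hIw hCv hCf]
  refine le_trans ?_ (extIntegral_mono hk)
  rw [extIntegral_coe hki, hkint, EReal.coe_add]
  refine add_le_add le_rfl ?_
  have hsint : ∫ ω in E, (s ω : ℝ) ∂μ = (∫⁻ ω in E, (s ω : ℝ≥0∞) ∂μ).toReal :=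
    integral_toReal (f := fun ω => (s ω : ℝ≥0∞)) hs.coe_nnreal_ennreal.aemeasurable
      (ae_of_all _ fun ω => ENNReal.coe_lt_top)
  rw [hsint, EReal.coe_ennreal_toReal hsE]
  exact EReal.coe_ennreal_le_coe_ennreal_iff.2 hLE

variable [CompleteSpace X]

lemma isEssSupOn_conjugateOn (h : Admissible μ R f v) (hA : A ∈ atomSigma μ) :
    ∃ m : Ω → EReal, IsEssSupOn μ A (fun (W : {W : Set X // IsSeparable W}) ω =>
      conjugateOn (f ω) (W : Set X) (v ω)) m := by
  obtain ⟨W, -, hW, -, hWm, hmax⟩ := h.exists_conjugateOn_max hA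
  exact ⟨_, hWm, fun W' => hmax W' W'.2, fun n _ hn => hn ⟨W, hW⟩⟩

/-- Separable sets that are maximal on `A` and on `B` dominate each other a.e. on the smaller set.
-/
lemma isConsistent_of_isEssSupOn (h : Admissible μ R f v) (hm : ∀ A ∈ atomSigma μ, IsEssSupOn μ A
      (fun (W : {W : Set X // IsSeparable W}) ω => conjugateOn (f ω) (W : Set X) (v ω)) (m A)) :
    IsConsistent μ m := by
  intro A hA B hB hAB
  obtain ⟨W, -, hW, -, hWm, hmax⟩ := h.exists_conjugateOn_max hA
  obtain ⟨W', -, hW', -, hWm', hmax'⟩ := h.exists_conjugateOn_max hB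
  filter_upwards [ae_eq_of_isEssSupOn (hm A hA) hW hWm hmax,
    ae_restrict_of_ae_restrict_of_subset hAB (ae_eq_of_isEssSupOn (hm B hB) hW' hWm' hmax'),
    hmax W' hW', ae_restrict_of_ae_restrict_of_subset hAB (hmax' W hW)] with ω h1 h2 h3 h4
  rw [h1, h2]
  exact le_antisymm h4 h3

/-- The conjugate of the integral functional is the integral of the essential supremum. -/
theorem conjugateFunctional_eq (h : Admissible μ R f v) (hm : ∀ A ∈ atomSigma μ, IsEssSupOn μ A
      (fun (W : {W : Set X // IsSeparable W}) ω => conjugateOn (f ω) (W : Set X) (v ω)) (m A)) :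
    conjugateFunctional μ f R v = exhIntegralFam μ m := by
  have hmc := h.isConsistent_of_isEssSupOn hm
  apply le_antisymm
  · refine iSup₂_le fun u hu => ?_
    by_cases hI : integralFunctional μ f u = ⊤
    · rw [hI, EReal.sub_top]; exact bot_le
    rw [h.pairing_sub_eq_exhIntegral hu hI]
    exact exhIntegralFam_mono (isConsistent_const _) hmc fun A hA => h.ae_apply_sub_le hm hu hA
  · obtain ⟨u, hu, hI⟩ := h.exists_ne_top
    by_cases hI' : integralFunctional μ f u = ⊥
    · refine le_trans ?_ (le_conjugateFunctional hu)
      rw [hI', EReal.sub_bot (h.pairing_ne_bot u hu)]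
      exact le_top
    obtain ⟨A₁, hA₁⟩ := (isConsistent_const (μ := μ) fun ω =>
      ((v ω (u ω) : ℝ) : EReal)).exists_isCarrier
    obtain ⟨A₂, hA₂⟩ := (isConsistent_const (μ := μ) fun ω => f ω (u ω)).exists_isCarrier
    obtain ⟨A₃, hA₃⟩ := hmc.exists_isCarrier
    set A := A₁ ∪ (A₂ ∪ A₃) with hAdef
    have hA : A ∈ atomSigma μ := union_mem_atomSigma hA₁.1 (union_mem_atomSigma hA₂.1 hA₃.1)
    have hAv := hA₁.mono hA Set.subset_union_left
    have hAf := hA₂.mono hA (Set.subset_union_left.trans Set.subset_union_right)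
    have hAm := hA₃.mono hA (Set.subset_union_right.trans Set.subset_union_right)
    obtain ⟨W, hWc, hW, hWn, hWm, hmax⟩ := h.exists_conjugateOn_max hA
    have hmW := ae_eq_of_isEssSupOn (hm A hA) hW hWm hmax
    have hfm := aemeasurable_integrand h.separablyMeasurable (h.stronglyMeasurable u hu) hA
    obtain ⟨q, hq, hqf⟩ := exists_integrable_of_extIntegral_finite hfm
      (extIntegral_restrict_ne_top (isConsistent_const (μ := μ) fun ω => f ω (u ω)) hI hA)
      (extIntegral_restrict_ne_bot (isConsistent_const (μ := μ) fun ω => f ω (u ω)) hI hI' hA)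
    have hpq : Integrable (fun ω => v ω (u ω) - q ω) (μ.restrict A) :=
      (h.integrable_apply hu hA).sub hq
    obtain ⟨g, hg, hgpq⟩ := hpq.1.aemeasurable
    have hgi : Integrable g (μ.restrict A) := hpq.congr hgpq
    have hgu : ∀ᵐ ω ∂(μ.restrict A),
        ((v ω (u ω) : ℝ) : EReal) - f ω (u ω) = (g ω : EReal) := by
      filter_upwards [hqf, hgpq] with ω h1 h2
      rw [h1, ← h2, EReal.coe_sub]
    have hgW : ∀ᵐ ω ∂(μ.restrict A), (g ω : EReal) ≤ conjugateOn (f ω) W (v ω) := by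
      filter_upwards [hgu, h.ae_apply_sub_le hm hu hA, hmW] with ω h1 h2 h3
      rw [← h1, ← h3]; exact h2
    obtain ⟨D, B, hD, hB, hDB, hAe, hBs, hDμ⟩ := exists_decomposition_of_mem_atomSigma hA
    have hDA : D ⊆ A := hAe ▸ Set.subset_union_left
    have hBA : B ⊆ A := hAe ▸ Set.subset_union_right
    -- On `D` the supremum is at most `0 ≤ g`, so no improvement of `u` is needed there.
    have hsplit : ∫⁻ ω in A, (conjugateOn (f ω) W (v ω) - (g ω : EReal)).toENNReal ∂μ =
        ∫⁻ ω in B, (conjugateOn (f ω) W (v ω) - (g ω : EReal)).toENNReal ∂μ := by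
      conv_lhs => rw [hAe, lintegral_union hB hDB]
      have : ∫⁻ ω in D, (conjugateOn (f ω) W (v ω) - (g ω : EReal)).toENNReal ∂μ = 0 := by
        rw [← lintegral_zero (μ := μ.restrict D)]
        refine lintegral_congr_ae ?_
        filter_upwards [h.ae_conjugateOn_nonpos hD hDμ hW,
          h.ae_nonneg_apply_sub hu hI hA hDA hD hDμ,
          ae_restrict_of_ae_restrict_of_subset hDA hgu] with ω h1 h2 h3
        rw [h3] at h2
        rw [EReal.toENNReal_eq_zero_iff, EReal.sub_nonpos]
        exact h1.trans h2
      rw [this, zero_add]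
    rw [hAm.exhIntegralFam_eq, extIntegral_congr hmW]
    refine (extIntegral_le_add_lintegral_sub hgi hWm hgW).trans ?_
    rw [hsplit]
    have hu_le : ((∫ ω in A, g ω ∂μ : ℝ) : EReal) ≤ conjugateFunctional μ f R v := by
      refine le_trans (le_of_eq ?_) (le_conjugateFunctional hu)
      rw [h.pairing_sub_eq_extIntegral hu hI hAv hAf, extIntegral_congr hgu, extIntegral_coe hgi]
    have hnonneg : 0 ≤ conjugateFunctional μ f R v - ((∫ ω in A, g ω ∂μ : ℝ) : EReal) := by
      rw [EReal.sub_nonneg (by simp) (by simp)]; exact hu_le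
    -- Every level strictly below the excess integral is reached by some `w` in `R`; this also
    -- covers an infinite excess.
    have key : ∫⁻ ω in B, (conjugateOn (f ω) W (v ω) - (g ω : EReal)).toENNReal ∂μ ≤
        (conjugateFunctional μ f R v - ((∫ ω in A, g ω ∂μ : ℝ) : EReal)).toENNReal := by
      refine le_of_forall_lt fun L hL => ?_
      obtain ⟨L', hLL', hL'⟩ := exists_between hL
      refine hLL'.trans_le ?_
      obtain ⟨w, hw, hwL⟩ := h.exists_add_le_pairing_sub hu hI hI' hAv hAf hBA hB hWc hW hWn hg
        hgi hgu hL'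
      rw [← EReal.coe_ennreal_le_coe_ennreal_iff, EReal.coe_toENNReal hnonneg,
        EReal.le_sub_iff_add_le (by simp) (by simp), add_comm]
      exact hwL.trans (le_conjugateFunctional hw)
    rw [← EReal.coe_ennreal_le_coe_ennreal_iff, EReal.coe_toENNReal hnonneg,
      EReal.le_sub_iff_add_le (by simp) (by simp), add_comm] at key
    exact key

end Admissible

end conjugate

/-! ### Subdifferentials -/

/-- The rearrangement behind Fenchel-Young with only `t` possibly infinite; it is used pointwise and
for `I_f`. -/
lemma coe_add_sub_le_iff (p q r : ℝ) (t : EReal) :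
    (r : EReal) + ((q : EReal) - p) ≤ t ↔ (q : EReal) - t ≤ (p : EReal) - r := by
  rw [← EReal.coe_sub, ← EReal.coe_sub, ← EReal.coe_add]
  induction t with
  | bot =>
    rw [EReal.coe_sub_bot]
    exact iff_of_false (by simp [-EReal.coe_add, -EReal.coe_sub])
      (by simp [-EReal.coe_add, -EReal.coe_sub])
  | top => simp
  | coe t =>
    rw [← EReal.coe_sub, EReal.coe_le_coe_iff, EReal.coe_le_coe_iff]
    constructor <;> intro h <;> linarith

lemma mem_subdifferentialOn_iff {X : Type*} [NormedAddCommGroup X] [NormedSpace ℝ X]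
    {g : X → EReal} {W : Set X} {x : X} (hx : x ∈ W) (ht : g x ≠ ⊤) (hb : g x ≠ ⊥)
    (x' : X →L[ℝ] ℝ) :
    x' ∈ subdifferentialOn g W x ↔ conjugateOn g W x' ≤ ((x' x : ℝ) : EReal) - g x := by
  have key : ∀ y, g x + ((x' (y - x) : ℝ) : EReal) ≤ g y ↔
      ((x' y : ℝ) : EReal) - g y ≤ ((x' x : ℝ) : EReal) - g x := by
    intro y
    lift g x to ℝ using ⟨ht, hb⟩ with r
    rw [map_sub, EReal.coe_sub]
    exact coe_add_sub_le_iff _ _ _ _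
  simp only [subdifferentialOn, conjugateOn, iSup₂_le_iff, Set.mem_ofPred_eq, key]
  exact ⟨fun h => h.2.2.2, fun h => ⟨hx, ht, hb, h⟩⟩

lemma conjugateOn_univ {X : Type*} [NormedAddCommGroup X] [NormedSpace ℝ X] (g : X → EReal)
    (x' : X →L[ℝ] ℝ) : conjugateOn g Set.univ x' = conjugate g x' := by
  simp [conjugateOn, conjugate]

section subdifferential

variable {Ω X : Type*} [MeasurableSpace Ω] [NormedAddCommGroup X] [NormedSpace ℝ X]
  [MeasurableSpace X] [BorelSpace X] {μ : Measure Ω} {R : Submodule ℝ (Ω → X)}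
  {S : Submodule ℝ (Ω → X →L[ℝ] ℝ)} {f : Ω → X → EReal}
  {v : Ω → X →L[ℝ] ℝ} {u w : Ω → X} {A B : Set Ω}

namespace Admissible

lemma pairing_sub (h : Admissible μ R f v) (hw : w ∈ R) (hu : u ∈ R) :
    pairing μ (w - u) v = pairing μ w v - pairing μ u v := by
  obtain ⟨A, hA⟩ := (isConsistent_const (μ := μ) fun ω =>
    ((v ω ((w - u) ω) : ℝ) : EReal)).exists_isCarrier
  obtain ⟨B, hB⟩ := (isConsistent_const (μ := μ) fun ω =>
    ((v ω (w ω) : ℝ) : EReal)).exists_isCarrier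
  obtain ⟨C, hC⟩ := (isConsistent_const (μ := μ) fun ω =>
    ((v ω (u ω) : ℝ) : EReal)).exists_isCarrier
  have hU := union_mem_atomSigma hA.1 (union_mem_atomSigma hB.1 hC.1)
  rw [h.pairing_eq (sub_mem hw hu) (hA.mono hU Set.subset_union_left),
    h.pairing_eq hw (hB.mono hU (Set.subset_union_left.trans Set.subset_union_right)),
    h.pairing_eq hu (hC.mono hU (Set.subset_union_right.trans Set.subset_union_right)),
    ← EReal.coe_sub, ← integral_sub (h.integrable_apply hw hU) (h.integrable_apply hu hU)]
  simp

/-- The pairing is finite and additive on `R`, so the subgradient inequality rearranges for each `w`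
separately. -/
lemma mem_subdifferentialFunctional_iff_conjugateFunctional (h : Admissible μ R f v) (hv : v ∈ S)
    (hu : u ∈ R) (hI : integralFunctional μ f u ≠ ⊤) (hI' : integralFunctional μ f u ≠ ⊥) :
    v ∈ subdifferentialFunctional μ f R S u ↔
      conjugateFunctional μ f R v ≤ pairing μ u v - integralFunctional μ f u := by
  have key : ∀ w ∈ R,
      (integralFunctional μ f u + pairing μ (w - u) v ≤ integralFunctional μ f w ↔
        pairing μ w v - integralFunctional μ f w ≤
          pairing μ u v - integralFunctional μ f u) := by
    intro w hw
    rw [h.pairing_sub hw hu]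
    have h1 := h.pairing_ne_top u hu
    have h2 := h.pairing_ne_bot u hu
    have h3 := h.pairing_ne_top w hw
    have h4 := h.pairing_ne_bot w hw
    lift integralFunctional μ f u to ℝ using ⟨hI, hI'⟩ with r
    lift pairing μ u v to ℝ using ⟨h1, h2⟩ with p
    lift pairing μ w v to ℝ using ⟨h3, h4⟩ with q
    exact coe_add_sub_le_iff _ _ _ _
  simp only [subdifferentialFunctional, conjugateFunctional, iSup₂_le_iff, Set.mem_ofPred_eq]
  exact ⟨fun h w hw => (key w hw).1 (h.2.2.2 w hw),
    fun h => ⟨hv, hI, hI', fun w hw => (key w hw).2 (h w hw)⟩⟩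

lemma ae_integrand_finite (h : Admissible μ R f v) (hu : u ∈ R)
    (hI : integralFunctional μ f u ≠ ⊤) (hI' : integralFunctional μ f u ≠ ⊥)
    (hA : A ∈ atomSigma μ) : ∀ᵐ ω ∂(μ.restrict A), f ω (u ω) ≠ ⊤ ∧ f ω (u ω) ≠ ⊥ := by
  obtain ⟨q, -, hqf⟩ := exists_integrable_of_extIntegral_finite
    (aemeasurable_integrand h.separablyMeasurable (h.stronglyMeasurable u hu) hA)
    (extIntegral_restrict_ne_top (isConsistent_const (μ := μ) fun ω => f ω (u ω)) hI hA)
    (extIntegral_restrict_ne_bot (isConsistent_const (μ := μ) fun ω => f ω (u ω)) hI hI' hA)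
  filter_upwards [hqf] with ω hω
  rw [hω]
  exact ⟨EReal.coe_ne_top _, EReal.coe_ne_bot _⟩

variable [CompleteSpace X]

/-- Both `I_f*(v)` and `⟨u,v⟩ - I_f(u)` are integrals of ordered integrands, the second finite;
equality of the integrals means a.e. equality with the essential supremum. -/
lemma mem_subdifferentialFunctional_iff_conjugateOn (h : Admissible μ R f v) (hv : v ∈ S)
    (hu : u ∈ R) (hI : integralFunctional μ f u ≠ ⊤) (hI' : integralFunctional μ f u ≠ ⊥) :
    v ∈ subdifferentialFunctional μ f R S u ↔
      ∀ A ∈ atomSigma μ, ∀ W : Set X, IsSeparable W → ∀ᵐ ω ∂(μ.restrict A),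
        conjugateOn (f ω) W (v ω) ≤ ((v ω (u ω) : ℝ) : EReal) - f ω (u ω) := by
  rw [h.mem_subdifferentialFunctional_iff_conjugateFunctional hv hu hI hI']
  have hex : ∀ A, ∃ m : Ω → EReal, A ∈ atomSigma μ →
      IsEssSupOn μ A (fun (W : {W : Set X // IsSeparable W}) ω =>
        conjugateOn (f ω) (W : Set X) (v ω)) m := by
    intro A
    by_cases hA : A ∈ atomSigma μ
    · obtain ⟨m, hm⟩ := h.isEssSupOn_conjugateOn hA
      exact ⟨m, fun _ => hm⟩
    · exact ⟨0, fun hA' => absurd hA' hA⟩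
  choose m hm using hex
  have hmc := h.isConsistent_of_isEssSupOn hm
  have hfin := h.pairing_sub_integralFunctional_finite hu hI hI'
  constructor
  · intro hle A hA W hW
    have heq := le_antisymm (le_conjugateFunctional hu) hle
    rw [h.conjugateFunctional_eq hm] at heq
    rw [h.pairing_sub_eq_exhIntegral hu hI] at heq hfin
    have hae := ae_eq_of_exhIntegralFam_eq (isConsistent_const _) hmc
      (fun A hA => h.aemeasurable_apply_sub hu hA) (fun A hA => (hm A hA).1)
      (fun A hA => h.ae_apply_sub_le hm hu hA) heq hfin.1 hfin.2 hA
    filter_upwards [hae, (hm A hA).2.1 ⟨W, hW⟩] with ω h1 h2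
    rw [h1]; exact h2
  · intro hW
    rw [h.conjugateFunctional_eq hm, h.pairing_sub_eq_exhIntegral hu hI]
    exact exhIntegralFam_mono hmc (isConsistent_const _) fun A hA =>
      (hm A hA).2.2 _ (h.aemeasurable_apply_sub hu hA) fun W => hW A hA W W.2

theorem mem_subdifferentialFunctional_iff (h : Admissible μ R f v) (hv : v ∈ S)
    (hu : u ∈ R) (hI : integralFunctional μ f u ≠ ⊤) (hI' : integralFunctional μ f u ≠ ⊥) :
    v ∈ subdifferentialFunctional μ f R S u ↔
      ∀ A ∈ atomSigma μ, ∀ W : Set X, IsSeparable W → (∀ᵐ ω ∂(μ.restrict A), u ω ∈ W) →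
        ∀ᵐ ω ∂(μ.restrict A), v ω ∈ subdifferentialOn (f ω) W (u ω) := by
  rw [h.mem_subdifferentialFunctional_iff_conjugateOn hv hu hI hI']
  constructor
  · intro hle A hA W hW huW
    filter_upwards [hle A hA W hW, huW, h.ae_integrand_finite hu hI hI' hA] with ω h1 h2 h3
    exact (mem_subdifferentialOn_iff h2 h3.1 h3.2 _).2 h1
  · intro hsub A hA W hW
    have huA : IsSeparable (u '' A) := by
      have := (h.stronglyMeasurable u hu A hA).isSeparable_range
      rwa [← Set.image_eq_range] at this
    -- Adding the range of `u` makes the set admissible without losing the inequality for `W`.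
    have huW : ∀ᵐ ω ∂(μ.restrict A), u ω ∈ W ∪ u '' A := by
      filter_upwards [ae_restrict_mem (measurableSet_of_mem_atomSigma hA)] with ω hω
      exact Or.inr ⟨ω, hω, rfl⟩
    filter_upwards [hsub A hA _ (hW.union huA) huW, huW, h.ae_integrand_finite hu hI hI' hA]
      with ω h1 h2 h3
    exact (conjugateOn_mono _ Set.subset_union_left _).trans
      ((mem_subdifferentialOn_iff h2 h3.1 h3.2 _).1 h1)

theorem mem_subdifferentialFunctional_iff_mem_iInter (h : Admissible μ R f v) (hv : v ∈ S)
    (hu : u ∈ R) (hI : integralFunctional μ f u ≠ ⊤) (hI' : integralFunctional μ f u ≠ ⊥)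
    (hne : (separableRange μ u).Nonempty) :
    v ∈ subdifferentialFunctional μ f R S u ↔
      v ∈ ⋂ W ∈ separableRange μ u,
        {v' | v' ∈ S ∧ IAE μ (fun ω => v' ω ∈ subdifferentialOn (f ω) W (u ω))} := by
  rw [h.mem_subdifferentialFunctional_iff hv hu hI hI']
  simp only [Set.mem_iInter, Set.mem_ofPred_eq]
  constructor
  · exact fun hsub W hW => ⟨hv, fun A hA => hsub A hA W hW.1 (hW.2 A hA)⟩
  · intro hsub A hA W hW huW
    obtain ⟨W₀, hW₀⟩ := hne
    -- `W` contains `u` only a.e. on `A`; joining `W₀` makes this hold i.a.e.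
    have hU : W ∪ W₀ ∈ separableRange μ u :=
      ⟨hW.union hW₀.1, fun A hA => (hW₀.2 A hA).mono fun ω hω => Or.inr hω⟩
    filter_upwards [(hsub _ hU).2 A hA, huW] with ω h1 h2
    exact ⟨h2, h1.2.1, h1.2.2.1, fun y hy => h1.2.2.2 y (Or.inl hy)⟩

theorem mem_subdifferentialFunctional_iff_iae (h : Admissible μ R f v) (hv : v ∈ S)
    (hsep : ∀ A ∈ atomSigma μ, ∃ W : Set X, IsSeparable W ∧
      ∀ᵐ ω ∂(μ.restrict A), conjugate (f ω) (v ω) = conjugateOn (f ω) W (v ω))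
    (hu : u ∈ R) (hI : integralFunctional μ f u ≠ ⊤) (hI' : integralFunctional μ f u ≠ ⊥) :
    v ∈ subdifferentialFunctional μ f R S u ↔
      v ∈ {v' | v' ∈ S ∧ IAE μ (fun ω => v' ω ∈ subdifferentialOn (f ω) Set.univ (u ω))} := by
  rw [h.mem_subdifferentialFunctional_iff_conjugateOn hv hu hI hI']
  constructor
  · refine fun hle => ⟨hv, fun A hA => ?_⟩
    obtain ⟨W, hW, hWe⟩ := hsep A hA
    filter_upwards [hle A hA W hW, hWe, h.ae_integrand_finite hu hI hI' hA] with ω h1 h2 h3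
    rw [mem_subdifferentialOn_iff (Set.mem_univ _) h3.1 h3.2, conjugateOn_univ, h2]
    exact h1
  · rintro ⟨-, hsub⟩ A hA W hW
    filter_upwards [hsub A hA, h.ae_integrand_finite hu hI hI' hA] with ω h1 h3
    rw [mem_subdifferentialOn_iff (Set.mem_univ _) h3.1 h3.2] at h1
    exact (conjugateOn_mono _ (Set.subset_univ _) _).trans h1

/-! ### The conjugate under the integral sign -/

/-- The supremum over a maximal `W` on each `A` lies below `f*(v)` and integrates to `I_f*(v)`,
which is finite; equal integrals thus force a.e. equality. -/
theorem conjugate_integral_iff (h : Admissible μ R f v) (ht : conjugateFunctional μ f R v < ⊤) :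
    ((∀ A ∈ atomSigma μ, AEMeasurable (fun ω => conjugate (f ω) (v ω)) (μ.restrict A)) ∧
        conjugateFunctional μ f R v = exhIntegral μ (fun ω => conjugate (f ω) (v ω))) ↔
      ∀ A ∈ atomSigma μ, ∃ W : Set X, IsSeparable W ∧
        ∀ᵐ ω ∂(μ.restrict A), conjugate (f ω) (v ω) = conjugateOn (f ω) W (v ω) := by
  have hex : ∀ A, ∃ W : Set X, A ∈ atomSigma μ → IsSeparable W ∧
      AEMeasurable (fun ω => conjugateOn (f ω) W (v ω)) (μ.restrict A) ∧
      ∀ W' : Set X, IsSeparable W' →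
        ∀ᵐ ω ∂(μ.restrict A), conjugateOn (f ω) W' (v ω) ≤ conjugateOn (f ω) W (v ω) := by
    intro A
    by_cases hA : A ∈ atomSigma μ
    · obtain ⟨W, -, hW, -, hWm, hmax⟩ := h.exists_conjugateOn_max hA
      exact ⟨W, fun _ => ⟨hW, hWm, hmax⟩⟩
    · exact ⟨∅, fun hA' => absurd hA' hA⟩
  choose W hW using hex
  have hm : ∀ A ∈ atomSigma μ, IsEssSupOn μ A (fun (W : {W : Set X // IsSeparable W}) ω =>
      conjugateOn (f ω) (W : Set X) (v ω)) (fun ω => conjugateOn (f ω) (W A) (v ω)) :=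
    fun A hA => ⟨(hW A hA).2.1, fun W' => (hW A hA).2.2 W' W'.2,
      fun n _ hn => hn ⟨W A, (hW A hA).1⟩⟩
  have hmc := h.isConsistent_of_isEssSupOn
    (m := fun A ω => conjugateOn (f ω) (W A) (v ω)) hm
  have heq := h.conjugateFunctional_eq (m := fun A ω => conjugateOn (f ω) (W A) (v ω)) hm
  constructor
  · rintro ⟨hmeas, hint⟩ A hA
    have hfin : conjugateFunctional μ f R v ≠ ⊤ ∧ conjugateFunctional μ f R v ≠ ⊥ :=
      ⟨ht.ne, h.conjugateFunctional_ne_bot⟩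
    rw [heq] at hint hfin
    have hae := ae_eq_of_exhIntegralFam_eq hmc (isConsistent_const _)
      (fun A hA => (hW A hA).2.1) hmeas
      (fun A _ => ae_of_all _ fun ω => conjugateOn_le_conjugate _ _) hint hfin.1 hfin.2 hA
    exact ⟨W A, (hW A hA).1, Filter.EventuallyEq.symm hae⟩
  · intro hsep
    have hae : ∀ A ∈ atomSigma μ, (fun ω => conjugateOn (f ω) (W A) (v ω)) =ᵐ[μ.restrict A]
        fun ω => conjugate (f ω) (v ω) := by
      intro A hA
      obtain ⟨W', hW', hWe⟩ := hsep A hA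
      filter_upwards [hWe, (hW A hA).2.2 W' hW'] with ω h1 h2
      exact le_antisymm (conjugateOn_le_conjugate _ _) (h1 ▸ h2)
    exact ⟨fun A hA => (hW A hA).2.1.congr (hae A hA),
      heq.trans (exhIntegralFam_congr hmc (isConsistent_const _) hae)⟩

theorem exists_isSeparable_iae_of_conjugate_integral (h : Admissible μ R f v)
    (ht : conjugateFunctional μ f R v < ⊤) (hne : ∀ u ∈ R, (separableRange μ u).Nonempty)
    (hmeas : ∀ A ∈ atomSigma μ, AEMeasurable (fun ω => conjugate (f ω) (v ω)) (μ.restrict A))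
    (hint : conjugateFunctional μ f R v = exhIntegral μ (fun ω => conjugate (f ω) (v ω))) :
    ∃ W : Set X, IsSeparable W ∧
      IAE μ (fun ω => conjugate (f ω) (v ω) = conjugateOn (f ω) W (v ω)) := by
  have hfin : conjugateFunctional μ f R v ≠ ⊤ ∧ conjugateFunctional μ f R v ≠ ⊥ :=
    ⟨ht.ne, h.conjugateFunctional_ne_bot⟩
  obtain ⟨u, hu, hI⟩ := h.exists_ne_top
  have hI' : integralFunctional μ f u ≠ ⊥ := by
    intro hbot
    have := le_conjugateFunctional (f := f) (μ := μ) (v := v) hu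
    rw [hbot, EReal.sub_bot (h.pairing_ne_bot u hu), top_le_iff] at this
    exact hfin.1 this
  have hfinu := h.pairing_sub_integralFunctional_finite hu hI hI'
  rw [h.pairing_sub_eq_exhIntegral hu hI] at hfinu
  have hsep := (h.conjugate_integral_iff ht).1 ⟨hmeas, hint⟩
  rw [hint] at hfin
  obtain ⟨A₁, hA₁⟩ := (isConsistent_const (μ := μ) fun ω =>
    conjugate (f ω) (v ω)).exists_isCarrier
  obtain ⟨A₂, hA₂⟩ := (isConsistent_const (μ := μ) fun ω =>
    ((v ω (u ω) : ℝ) : EReal) - f ω (u ω)).exists_isCarrier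
  have hA₀ := union_mem_atomSigma hA₁.1 hA₂.1
  obtain ⟨W₀, hW₀⟩ := hne u hu
  obtain ⟨W₁, hW₁, hW₁e⟩ := hsep _ hA₀
  refine ⟨W₁ ∪ W₀, hW₁.union hW₀.1, fun A hA => ?_⟩
  have hU := union_mem_atomSigma hA₀ hA
  have h0 := (hA₁.mono hA₀ Set.subset_union_left).ae_eq_zero (isConsistent_const _) hfin.1 hfin.2
    hU Set.subset_union_left (hmeas _ hU)
  have h0' := (hA₂.mono hA₀ Set.subset_union_right).ae_eq_zero (isConsistent_const _) hfinu.1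
    hfinu.2 hU Set.subset_union_left (h.aemeasurable_apply_sub hu hU)
  rw [ae_restrict_iff' (measurableSet_of_mem_atomSigma hA₀)] at hW₁e
  refine ae_restrict_of_ae_restrict_of_subset (t := A₁ ∪ A₂ ∪ A) Set.subset_union_right ?_
  filter_upwards [h0, h0', ae_restrict_of_ae hW₁e, hW₀.2 _ hU] with ω h1 h2 h3 h4
  refine le_antisymm ?_ (conjugateOn_le_conjugate _ _)
  -- On the common carrier `W₁` realizes the conjugate; off it both `f*(v)` and `⟨v,u⟩ - f(u)` are
  -- `0`, and `u ω ∈ W₀` attains this value.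
  by_cases hω : ω ∈ A₁ ∪ A₂
  · rw [h3 hω]
    exact conjugateOn_mono _ Set.subset_union_left _
  · rw [h1 hω, ← h2 hω]
    exact le_conjugateOn _ (Set.mem_union_right W₁ h4) _

end Admissible

end subdifferential

end IntegralConjugate

end

/-! ### The main theorem -/

open IntegralConjugate in
theorem theorem2p4 {Ω X : Type*} [MeasurableSpace Ω] (μ : Measure Ω)
    [NormedAddCommGroup X] [NormedSpace ℝ X] [CompleteSpace X]
    [MeasurableSpace X] [BorelSpace X]
    (R : Submodule ℝ (Ω → X)) (S : Submodule ℝ (Ω → X →L[ℝ] ℝ))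
    (hR : ∀ u ∈ R, IntegrallyStronglyMeasurable μ u)
    (hRdec : AlmostDecomposable μ (R : Set (Ω → X)))
    (hS : ∀ v ∈ S, IntegrallyWeakStarMeasurable μ v)
    (hpair : ∀ u ∈ R, ∀ v ∈ S, pairing μ u v ≠ ⊤ ∧ pairing μ u v ≠ ⊥)
    (f : Ω → X → EReal) (hf : IntegrallySeparablyMeasurable μ f)
    (hI : ∃ u ∈ R, integralFunctional μ f u ≠ ⊤)
    (v : Ω → X →L[ℝ] ℝ) (hv : v ∈ S)
    (hatom : ∀ A : Set Ω, IsMeasureAtom μ A → μ A = ∞ → ∀ W : Set X, IsSeparable W →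
      ∀ᵐ ω ∂(μ.restrict A), conjugateOn (f ω) W (v ω) ≤ 0) :
    -- the essential supremum exists on each set of `atomSigma μ`, and its integral is `I_f*(v)`
    ((∀ A ∈ atomSigma μ, ∃ m : Ω → EReal,
        IsEssSupOn μ A (fun (W : {W : Set X // IsSeparable W}) ω =>
          conjugateOn (f ω) (W : Set X) (v ω)) m) ∧
      ∀ m : Set Ω → Ω → EReal,
        (∀ A ∈ atomSigma μ, IsEssSupOn μ A (fun (W : {W : Set X // IsSeparable W}) ω =>
          conjugateOn (f ω) (W : Set X) (v ω)) (m A)) →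
        conjugateFunctional μ f R v = exhIntegralFam μ m) ∧
    -- the subdifferential
    (∀ u ∈ R, integralFunctional μ f u ≠ ⊤ → integralFunctional μ f u ≠ ⊥ →
      (v ∈ subdifferentialFunctional μ f R S u ↔
        ∀ A ∈ atomSigma μ, ∀ W : Set X, IsSeparable W → (∀ᵐ ω ∂(μ.restrict A), u ω ∈ W) →
          ∀ᵐ ω ∂(μ.restrict A), v ω ∈ subdifferentialOn (f ω) W (u ω)) ∧
      ((separableRange μ u).Nonempty →
        (v ∈ subdifferentialFunctional μ f R S u ↔
          v ∈ ⋂ W ∈ separableRange μ u,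
            {v' | v' ∈ S ∧ IAE μ (fun ω => v' ω ∈ subdifferentialOn (f ω) W (u ω))}))) ∧
    -- the conjugate under the integral sign
    (conjugateFunctional μ f R v < ⊤ →
      (((∀ A ∈ atomSigma μ, AEMeasurable (fun ω => conjugate (f ω) (v ω)) (μ.restrict A)) ∧
          conjugateFunctional μ f R v = exhIntegral μ (fun ω => conjugate (f ω) (v ω))) ↔
        ∀ A ∈ atomSigma μ, ∃ W : Set X, IsSeparable W ∧
          ∀ᵐ ω ∂(μ.restrict A), conjugate (f ω) (v ω) = conjugateOn (f ω) W (v ω)) ∧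
      ((∀ u ∈ R, (separableRange μ u).Nonempty) →
        (((∀ A ∈ atomSigma μ, AEMeasurable (fun ω => conjugate (f ω) (v ω)) (μ.restrict A)) ∧
            conjugateFunctional μ f R v = exhIntegral μ (fun ω => conjugate (f ω) (v ω))) ↔
          ∃ W : Set X, IsSeparable W ∧
            IAE μ (fun ω => conjugate (f ω) (v ω) = conjugateOn (f ω) W (v ω)))) ∧
      ((∀ A ∈ atomSigma μ, ∃ W : Set X, IsSeparable W ∧
          ∀ᵐ ω ∂(μ.restrict A), conjugate (f ω) (v ω) = conjugateOn (f ω) W (v ω)) →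
        ∀ u ∈ R, integralFunctional μ f u ≠ ⊤ → integralFunctional μ f u ≠ ⊥ →
          (v ∈ subdifferentialFunctional μ f R S u ↔
            v ∈ {v' | v' ∈ S ∧
              IAE μ (fun ω => v' ω ∈ subdifferentialOn (f ω) Set.univ (u ω))}))) := by
  have h : Admissible μ R f v := ⟨hR, hRdec, hS v hv, fun u hu => (hpair u hu v hv).1,
    fun u hu => (hpair u hu v hv).2, hf, hI, hatom⟩
  refine ⟨⟨fun A hA => h.isEssSupOn_conjugateOn hA, fun m hm => h.conjugateFunctional_eq hm⟩,
    fun u hu hIu hIu' => ⟨h.mem_subdifferentialFunctional_iff hv hu hIu hIu',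
      fun hne => h.mem_subdifferentialFunctional_iff_mem_iInter hv hu hIu hIu' hne⟩,
    fun ht => ⟨h.conjugate_integral_iff ht, fun hne => ⟨fun hi =>
      h.exists_isSeparable_iae_of_conjugate_integral ht hne hi.1 hi.2, ?_⟩,
      fun hsep u hu hIu hIu' =>
        h.mem_subdifferentialFunctional_iff_iae hv hsep hu hIu hIu'⟩⟩
  rintro ⟨W, hW, hWe⟩
  exact (h.conjugate_integral_iff ht).2 fun A hA => ⟨W, hW, hWe A hA⟩
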